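/- Consider the model of $n\ge 2$ noisy, randomly shifted curves $$dY_j(x)=f(x-\tau_j)\,dx+\epsilon\,dW_j(x),\qquad x\in[0,1],\ j=1,\dots,n,$$ where $f:\mathbb R\to\mathbb R$ is $1$-periodic with $\int_0^1 f^2<\infty$, $\epsilon\ge 0$, the $W_j$ are independent standard Brownian motions, the shifts $\tau_j$ are i.i.d. with a known density $g$ on $\mathbb R$, and the shifts are independent of the Brownian motions. For $k\in\mathbb Z$ put $$\theta_k=\int_0^1 e^{-2i\pi kx}f(x)\,dx,\quad \gamma_k=\int_{\mathbb R}e^{-2i\pi kx}g(x)\,dx,\quad \tilde c_k=\frac1n\sum_{j=1}^n\int_0^1 e^{-2i\pi kx}\,dY_j(x),$$ and $\|\theta\|^2=\sum_{k\in\mathbb Z}|\theta_k|^2$. For $N\in\mathbb N=\{0,1,2,\dots\}$ define the penalized criterion $$\bar U(Y,N)=-\sum_{|k|\le N}|\gamma_k|^{-2}\Big\{|\tilde c_k|^2-\frac{\epsilon^2}{n}\Big\}+\frac{\epsilon^2}{n}\sum_{|k|\le N}|\gamma_k|^{-2}+\frac{\log^2 n}{n}\sum_{|k|\le N}|\gamma_k|^{-4}\Big\{|\tilde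 c_k|^2-\frac{\epsilon^2}{n}\Big\}$$ and the risk $$\bar R(\theta,N)=\sum_{|k|>N}|\theta_k|^2+\frac{\epsilon^2}{n}\sum_{|k|\le N}|\gamma_k|^{-2}+\frac{\log^2 n}{n}\sum_{|k|\le N}|\gamma_k|^{-2}|\theta_k|^2 .$$ Let $m_0=\inf\{k\in\mathbb N:|\gamma_k|^2\le \log^2(n)/n\}-1$, let $N^\star$ be any (measurable) minimizer of $N\mapsto\bar U(Y,N)$ over the integers $0\le N\le m_0$, and let $\theta^\star_k=\gamma_k^{-1}\tilde c_k\,\mathbf 1_{\{|k|\le N^\star\}}$ for $k\in\mathbb Z$. Let $\beta\ge 0$ and $C_{\max}\ge C_{\min}>0$. There exist $\gamma_1\in(0,1)$ and a function $h_1$ with $h_1(\gamma)\to0$ as $\gamma\to0^+$, depending only on $\beta,C_{\min},C_{\max}$, and for every $A$ a constant $C_1>0$, depending only on $\beta,C_{\min},C_{\max},A$ (in particular independent of $\epsilon$, $n$ and $\gamma$), such that the following holds. If $C_{\min}|k|^{-\beta}\le|\gamma_k|\le C_{\max}|k|^{-\beta}$ for all $k\in\mathbb Z\setminus\{0\}$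 and $\|\theta\|^2=\int_0^1 f^2\le A$, then for all $n\ge2$, all $\epsilon\ge0$ and all $0<\gamma<\gamma_1$, $$\mathbb E\,\|\theta^\star-\theta\|^2\le(1+h_1(\gamma))\inf_{0\le N\le m_0}\bar R(\theta,N)+\frac{C_1\epsilon^2}{n}\,\frac1{\gamma^{4\beta+1}}+\frac{C_1}{n\gamma}.$$ -/

import Mathlib

open MeasureTheory ProbabilityTheory Set Filter Topology
open scoped NNReal ENNReal

noncomputable section

namespace ShiftedCurves

/-- The Fourier mode `x ↦ exp (-2 i π k x)`. -/
def mode (k : ℤ) (x : ℝ) : ℂ :=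
  Complex.exp (-(2 * Real.pi * k * x : ℝ) * Complex.I)

/-- Fourier coefficients `θ_k` of a `1`-periodic template `f`. -/
def templateCoeff (f : ℝ → ℝ) (k : ℤ) : ℂ :=
  ∫ x in (0 : ℝ)..1, mode k x * (f x : ℂ)

/-- Fourier coefficients `γ_k` of the density `g` of the shifts. -/
def shiftCoeff (g : ℝ → ℝ) (k : ℤ) : ℂ :=
  ∫ x : ℝ, mode k x * (g x : ℂ)

/-- `f` is a real `1`-periodic function, square integrable over a period. -/
structure IsTemplate (f : ℝ → ℝ) : Prop where
  periodic : Function.Periodic f 1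
  memLp : MemLp f 2 (volume.restrict (Ioc (0 : ℝ) 1))

/-- `g` is a probability density with respect to the Lebesgue measure on `ℝ`. -/
structure IsDensity (g : ℝ → ℝ) : Prop where
  measurable : Measurable g
  nonneg : ∀ x, 0 ≤ g x
  integrable : Integrable g
  integral_eq_one : ∫ x, g x = 1

/-- Polynomial decay at rate `β` of the Fourier coefficients of `g`. The frequency `0`, where
`|k| ^ (-β)` is not defined and where `γ_0 = 1`, is left out. -/
def PolynomialDecay (g : ℝ → ℝ) (β Cmin Cmax : ℝ) : Prop :=
  ∀ k : ℤ, k ≠ 0 →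
    Cmin * |(k : ℝ)| ^ (-β) ≤ ‖shiftCoeff g k‖ ∧ ‖shiftCoeff g k‖ ≤ Cmax * |(k : ℝ)| ^ (-β)

/-- The random inputs of `n` noisy, randomly shifted curves: i.i.d. shifts `τ_j` with density `g`,
independent standard Brownian motions `W_j`, the shifts being independent of the noise. -/
structure IsShiftNoise {Ω : Type*} [MeasurableSpace Ω] (μ : Measure Ω) (g : ℝ → ℝ) {n : ℕ}
    (τ : Fin n → Ω → ℝ) (W : Fin n → ℝ≥0 → Ω → ℝ) : Prop where
  measurable_shift : ∀ j, Measurable (τ j)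
  measurable_noise : ∀ j t, Measurable (W j t)
  law_shift : ∀ j, μ.map (τ j) = volume.withDensity (fun x => ENNReal.ofReal (g x))
  indep_shift : iIndepFun τ μ
  brownian : ∀ j, IsBrownianReal (W j) μ
  indep_noise : iIndepFun (fun j ω t => W j t ω) μ
  indep_shift_noise : IndepFun (fun ω j => τ j ω) (fun ω j t => W j t ω) μ

/-- The curve `Y` on `[0, 1]` with `Y(0) = ε w(0)` and `dY(x) = f(x - t) dx + ε dw(x)`, for a
shift `t` and a noise path `w`. -/
def curve (f : ℝ → ℝ) (ε t : ℝ) (w : ℝ≥0 → ℝ) (x : ℝ) : ℝ :=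
  (∫ u in (0 : ℝ)..x, f (u - t)) + ε * w x.toNNReal

/-- The (Wiener) integral `∫_0^1 φ(x) dY(x)` of a continuously differentiable `φ` against a
continuous path `Y`, by integration by parts. -/
def pathIntegral (φ : ℝ → ℂ) (Y : ℝ → ℝ) : ℂ :=
  φ 1 * (Y 1 : ℂ) - φ 0 * (Y 0 : ℂ) - ∫ x in (0 : ℝ)..1, deriv φ x * (Y x : ℂ)

/-- The averaged empirical Fourier coefficient
`c̃_k = (1/n) ∑_j ∫_0^1 exp (-2 i π k x) dY_j(x)`. -/
def empCoeff {Ω : Type*} {n : ℕ} (f : ℝ → ℝ) (ε : ℝ) (τ : Fin n → Ω → ℝ)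
    (W : Fin n → ℝ≥0 → Ω → ℝ) (ω : Ω) (k : ℤ) : ℂ :=
  (1 / (n : ℂ)) * ∑ j, pathIntegral (mode k) (curve f ε (τ j ω) (fun t => W j t ω))

/-- The frequencies `|k| ≤ N`. -/
def freqs (N : ℕ) : Finset ℤ := Finset.Icc (-(N : ℤ)) (N : ℤ)

/-- The maximal bandwidth `m_0 = inf {k : |γ_k|² ≤ log² n / n} - 1`. -/
def maxBandwidth (g : ℝ → ℝ) (n : ℕ) : ℕ :=
  sInf {k : ℕ | ‖shiftCoeff g k‖ ^ 2 ≤ Real.log n ^ 2 / n} - 1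

/-- The penalized unbiased risk criterion, for known `γ` and empirical coefficients `c`. -/
def criterion (γ : ℤ → ℂ) (n : ℕ) (ε : ℝ) (c : ℤ → ℂ) (N : ℕ) : ℝ :=
  -(∑ k ∈ freqs N, (‖γ k‖ ^ 2)⁻¹ * (‖c k‖ ^ 2 - ε ^ 2 / n))
    + ε ^ 2 / n * ∑ k ∈ freqs N, (‖γ k‖ ^ 2)⁻¹
    + Real.log n ^ 2 / n * ∑ k ∈ freqs N, (‖γ k‖ ^ 4)⁻¹ * (‖c k‖ ^ 2 - ε ^ 2 / n)

/-- `N` minimizes the function `U` over the integers `0, …, m`. -/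
def IsArgminUpTo (U : ℕ → ℝ) (m N : ℕ) : Prop :=
  N ≤ m ∧ ∀ M ≤ m, U N ≤ U M

/-- The spectral cut-off estimator with cut-off `N`. -/
def cutoffEstimator (γ c : ℤ → ℂ) (N : ℕ) (k : ℤ) : ℂ :=
  if |k| ≤ (N : ℤ) then c k / γ k else 0

/-- The risk `R̄(θ, N)` with a `log² n / n` extra variance term. -/
def penalizedRisk (γ θ : ℤ → ℂ) (n : ℕ) (ε : ℝ) (N : ℕ) : ℝ :=
  (∑' k : {k : ℤ // (N : ℤ) < |k|}, ‖θ k‖ ^ 2)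
    + ε ^ 2 / n * ∑ k ∈ freqs N, (‖γ k‖ ^ 2)⁻¹
    + Real.log n ^ 2 / n * ∑ k ∈ freqs N, (‖γ k‖ ^ 2)⁻¹ * ‖θ k‖ ^ 2

end ShiftedCurves

end

namespace ShiftedCurves

/-! ### The deterministic oracle inequality along one realisation -/

section

open scoped ComplexConjugate

/-! Dividing the empirical coefficients by γ_k gives a sequence model y_k = θ_k (1 + z_k) + η_k
(`empCoeff_eq`), where z_k is the relative error of the empirical Fourier coefficient of the shifts
and η_k is Gaussian noise of variance s a_k, with s = ε²/n and a_k = |γ_k|⁻². With L = log² n / n,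
the criterion is -∑ (1 - L a_k)(|y_k|² - s a_k) + s ∑ a_k over |k| ≤ N (`criterion_eq`). Up to a
constant free of N it equals the risk R̄(θ, N) plus fluctuations, because minus the energy inside
the band is the tail energy minus the total energy.

`pathwise_oracle` compares the selected N with a fixed competitor N₀. For any small δ, every
fluctuation is bounded by δ times the risk terms at N and N₀ plus a nonnegative excess. The log²
penalty is what absorbs the quadratic effect of the shifts; the linear effects of shifts and noise
involve only the frequencies between N and N₀, whose energy is at most the tail energy at the
smaller bandwidth.

It remains to bound the expected excesses. For the shifts, Hoeffding's lemma makes each excess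
O(1/n), since exceeding a multiple of log n costs a factor exp(-log n) (`shift_excess`); weighted by
|θ_k|² they sum to O(‖θ‖²/n). For the noise, Laplace transforms of linear and quadratic forms in
independent Gaussians give bounds of the form s · (M+1)^(2β) exp(-c(M+1)) at bandwidth M
(`bandwidth_excess`, `quadratic_excess`), because polynomial decay of γ_k makes the ratio of ∑ a_k
to max a_k grow linearly. These are summable, so N may be random: the excesses are simply added over
all bandwidths. Gaussianity and independence of the noise coefficients come from the characteristic
functions of Riemann sums of Brownian increments (`iIndepFun_noiseCoeff`).

This gives, for each δ, factor 1 + 10δ and remainders with constants K(δ) (`oracle_inequality`).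
Finally δ is tied to γ, tending to 0 so slowly that K(δ) ≤ 1/γ (`exists_tendsto_atTop_le_inv`);
since 1/γ ≤ γ^(-(4β+1)) for γ ≤ 1, both remainders have the required form. -/

theorem mem_freqs {N : ℕ} {k : ℤ} : k ∈ freqs N ↔ |k| ≤ (N : ℤ) := by
  simp [freqs, abs_le]

theorem freqs_mono {N M : ℕ} (h : N ≤ M) : freqs N ⊆ freqs M := by
  intro k hk
  rw [mem_freqs] at *
  exact hk.trans (by exact_mod_cast h)

theorem norm_signal_add_noise_sq (θ z η : ℂ) :
    ‖θ * (1 + z) + η‖ ^ 2 = ‖θ‖ ^ 2 + 2 * (θ * conj η).re + ‖η‖ ^ 2 + 2 * ‖θ‖ ^ 2 * z.re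
      + 2 * (θ * z * conj η).re + ‖θ * z‖ ^ 2 := by
  simp only [← Complex.normSq_eq_norm_sq, Complex.normSq_apply, Complex.add_re, Complex.mul_re,
    Complex.add_im, Complex.mul_im, Complex.one_re, Complex.one_im, Complex.conj_re,
    Complex.conj_im]
  ring

theorem two_mul_re_mul_conj_le {δ : ℝ} (hδ : 0 < δ) (u v : ℂ) :
    |2 * (u * conj v).re| ≤ δ * ‖v‖ ^ 2 + δ⁻¹ * ‖u‖ ^ 2 := by
  have h1 : |(u * conj v).re| ≤ ‖u‖ * ‖v‖ := by
    simpa using Complex.abs_re_le_norm (u * conj v)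
  rw [abs_mul, abs_two]
  have h2 : 0 ≤ δ * (‖v‖ - δ⁻¹ * ‖u‖) ^ 2 := by positivity
  have h3 : δ * (‖v‖ - δ⁻¹ * ‖u‖) ^ 2 = δ * ‖v‖ ^ 2 + δ⁻¹ * ‖u‖ ^ 2 - 2 * (‖u‖ * ‖v‖) := by
    field_simp; ring
  linarith

/-- Here r stands for L a_k. Its bound by 1 up to the maximal bandwidth makes the typical size of
the shift error at most δ; the rest is 2δ‖z‖ ≤ δ² + ‖z‖². -/
theorem norm_le_of_norm_sq_le {δ r P : ℝ} (hδ : 0 < δ) (hr : r ≤ 1) {z : ℂ}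
    (hz : ‖z‖ ^ 2 ≤ δ ^ 2 * r + P) : ‖z‖ ≤ δ + (2 * δ)⁻¹ * P := by
  have h : ‖z‖ ^ 2 ≤ δ ^ 2 + P := by nlinarith [sq_nonneg δ]
  have h2 : 2 * δ * ‖z‖ ≤ 2 * δ ^ 2 + P := by nlinarith [sq_nonneg (‖z‖ - δ)]
  have h3 : ‖z‖ ≤ (2 * δ)⁻¹ * (2 * δ ^ 2 + P) := by
    rw [← div_eq_inv_mul, le_div_iff₀ (by positivity)]; linarith
  calc ‖z‖ ≤ _ := h3
    _ = _ := by field_simp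

set_option maxHeartbeats 1000000 in
/-- The oracle inequality along one realisation, with the fluctuations collected in the
nonnegative remainders `P`, `G`, `H`, `H'`. -/
theorem pathwise_oracle {m N N₀ : ℕ} (hN : N ≤ m) (hN₀ : N₀ ≤ m) {δ L s G H H' : ℝ}
    (hδ : 0 < δ) (hδ6 : δ ≤ 1 / 6) (hL : 0 ≤ L) (hs : 0 ≤ s) {a P : ℤ → ℝ} {θ z η : ℤ → ℂ}
    (ha : ∀ k, 0 ≤ a k) (hLa : ∀ k ∈ freqs m, L * a k ≤ 1) (hP : ∀ k, 0 ≤ P k)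
    (hz : ∀ k ∈ freqs m, ‖z k‖ ^ 2 ≤ δ ^ 2 * (L * a k) + P k) {B : ℕ → ℝ} (hB0 : ∀ M, 0 ≤ B M)
    (hB : ∀ M M', M ≤ M' → B M = B M' + ∑ k ∈ freqs M' \ freqs M, ‖θ k‖ ^ 2)
    (hU : -(∑ k ∈ freqs N, (1 - L * a k) * (‖θ k * (1 + z k) + η k‖ ^ 2 - s * a k))
        + s * ∑ k ∈ freqs N, a k
      ≤ -(∑ k ∈ freqs N₀, (1 - L * a k) * (‖θ k * (1 + z k) + η k‖ ^ 2 - s * a k))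
        + s * ∑ k ∈ freqs N₀, a k)
    (hG : 4 * |∑ k ∈ freqs N, (1 - L * a k) * (θ k * conj (η k)).re
        - ∑ k ∈ freqs N₀, (1 - L * a k) * (θ k * conj (η k)).re|
      ≤ G + δ * (B N + B N₀ + s * ∑ k ∈ freqs N, a k + s * ∑ k ∈ freqs N₀, a k))
    (hH : ∑ k ∈ freqs N, (1 + 3 * δ + (1 + 5 * δ) * (1 - L * a k)) * (‖η k‖ ^ 2 - s * a k)
      ≤ H + δ * (s * ∑ k ∈ freqs N, a k))
    (hH' : ∑ k ∈ freqs N₀, (2 * δ - (1 + 5 * δ) * (1 - L * a k)) * (‖η k‖ ^ 2 - s * a k)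
      ≤ H' + δ * (s * ∑ k ∈ freqs N₀, a k)) :
    B N + ∑ k ∈ freqs N, ‖θ k * z k + η k‖ ^ 2
      ≤ (1 + 10 * δ) * (B N₀ + s * ∑ k ∈ freqs N₀, a k
          + L * ∑ k ∈ freqs N₀, a k * ‖θ k‖ ^ 2)
        + 10 * δ⁻¹ * ∑ k ∈ freqs m, ‖θ k‖ ^ 2 * P k + G + H + H' := by
  set Q := ∑ k ∈ freqs m, ‖θ k‖ ^ 2 * P k with hQ
  have hQ0 : 0 ≤ Q := Finset.sum_nonneg fun k _ => by have := hP k; positivity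
  have hδi : 0 < δ⁻¹ := by positivity
  have hδi6 : 6 ≤ δ⁻¹ := by
    rw [le_inv_comm₀ (by norm_num) hδ]; linarith
  -- splitting of the weighted squares
  have split : ∀ M, ∑ k ∈ freqs M, (1 - L * a k) * (‖θ k * (1 + z k) + η k‖ ^ 2 - s * a k)
      = ∑ k ∈ freqs M, ‖θ k‖ ^ 2 - L * ∑ k ∈ freqs M, a k * ‖θ k‖ ^ 2
        + 2 * ∑ k ∈ freqs M, (1 - L * a k) * (θ k * conj (η k)).re
        + ∑ k ∈ freqs M, (1 - L * a k) * (2 * ‖θ k‖ ^ 2 * (z k).re)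
        + ∑ k ∈ freqs M, (1 - L * a k) * (‖η k‖ ^ 2 - s * a k
          + 2 * (θ k * z k * conj (η k)).re + ‖θ k * z k‖ ^ 2) := by
    intro M
    rw [Finset.mul_sum, Finset.mul_sum, ← Finset.sum_sub_distrib, ← Finset.sum_add_distrib,
      ← Finset.sum_add_distrib, ← Finset.sum_add_distrib]
    refine Finset.sum_congr rfl fun k _ => ?_
    rw [norm_signal_add_noise_sq]
    ring
  have hBΘ : ∀ M ≤ m, B M + ∑ k ∈ freqs M, ‖θ k‖ ^ 2 = B m + ∑ k ∈ freqs m, ‖θ k‖ ^ 2 := by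
    intro M hM
    rw [hB M m hM, ← Finset.sum_sdiff (freqs_mono hM)]; ring
  have quad : ∀ M ≤ m, ∑ k ∈ freqs M, ‖θ k * z k‖ ^ 2
      ≤ δ ^ 2 * (L * ∑ k ∈ freqs M, a k * ‖θ k‖ ^ 2) + Q := by
    intro M hM
    have h1 : ∑ k ∈ freqs M, ‖θ k‖ ^ 2 * P k ≤ Q :=
      Finset.sum_le_sum_of_subset_of_nonneg (freqs_mono hM) fun k _ _ => by
        have := hP k; positivity
    refine le_trans ?_ (add_le_add_right h1 _)
    rw [Finset.mul_sum, Finset.mul_sum, ← Finset.sum_add_distrib]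
    refine Finset.sum_le_sum fun k hk => ?_
    rw [norm_mul, mul_pow]
    have := mul_le_mul_of_nonneg_left (hz k (freqs_mono hM hk)) (sq_nonneg ‖θ k‖)
    linarith
  -- the linear term in the shifts
  have lin_aux : ∀ M M', M ≤ M' → M' ≤ m →
      |∑ k ∈ freqs M', (1 - L * a k) * (2 * ‖θ k‖ ^ 2 * (z k).re)
        - ∑ k ∈ freqs M, (1 - L * a k) * (2 * ‖θ k‖ ^ 2 * (z k).re)|
      ≤ 2 * δ * B M + δ⁻¹ * Q := by
    intro M M' h h'
    have e : ∑ k ∈ freqs M', (1 - L * a k) * (2 * ‖θ k‖ ^ 2 * (z k).re)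
        - ∑ k ∈ freqs M, (1 - L * a k) * (2 * ‖θ k‖ ^ 2 * (z k).re)
        = ∑ k ∈ freqs M' \ freqs M, (1 - L * a k) * (2 * ‖θ k‖ ^ 2 * (z k).re) := by
      rw [← Finset.sum_sdiff (freqs_mono h)]; ring
    rw [e]
    -- Only the frequencies between the two bandwidths remain, and their energy is at most the tail
    -- energy `B M` of the smaller one.
    refine (Finset.abs_sum_le_sum_abs _ _).trans ?_
    have h1 : ∀ k ∈ freqs M' \ freqs M, |(1 - L * a k) * (2 * ‖θ k‖ ^ 2 * (z k).re)|
        ≤ 2 * δ * ‖θ k‖ ^ 2 + δ⁻¹ * (‖θ k‖ ^ 2 * P k) := by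
      intro k hk
      have hkm : k ∈ freqs m := freqs_mono h' (Finset.mem_sdiff.1 hk).1
      have b1 := norm_le_of_norm_sq_le hδ (hLa k hkm) (hz k hkm)
      have b2 : |(z k).re| ≤ ‖z k‖ := Complex.abs_re_le_norm _
      have b3 : |1 - L * a k| ≤ 1 := by
        rw [abs_le]; constructor <;> nlinarith [hLa k hkm, mul_nonneg hL (ha k)]
      calc |(1 - L * a k) * (2 * ‖θ k‖ ^ 2 * (z k).re)|
          = |1 - L * a k| * (2 * ‖θ k‖ ^ 2 * |(z k).re|) := by
            rw [abs_mul, abs_mul, abs_mul, abs_two, abs_of_nonneg (sq_nonneg ‖θ k‖)]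
        _ ≤ 1 * (2 * ‖θ k‖ ^ 2 * (δ + (2 * δ)⁻¹ * P k)) := by
            gcongr
            exact b2.trans b1
        _ = _ := by field_simp
    refine (Finset.sum_le_sum h1).trans ?_
    rw [Finset.sum_add_distrib, ← Finset.mul_sum, ← Finset.mul_sum]
    have h2 : ∑ k ∈ freqs M' \ freqs M, ‖θ k‖ ^ 2 ≤ B M := by
      have := hB M M' h; have := hB0 M'; linarith
    have h3 : ∑ k ∈ freqs M' \ freqs M, ‖θ k‖ ^ 2 * P k ≤ Q :=
      Finset.sum_le_sum_of_subset_of_nonneg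
        (Finset.sdiff_subset.trans (freqs_mono h')) fun k _ _ => by have := hP k; positivity
    gcongr
  have lin : |∑ k ∈ freqs N, (1 - L * a k) * (2 * ‖θ k‖ ^ 2 * (z k).re)
        - ∑ k ∈ freqs N₀, (1 - L * a k) * (2 * ‖θ k‖ ^ 2 * (z k).re)|
      ≤ 2 * δ * (B N + B N₀) + δ⁻¹ * Q := by
    rcases le_total N N₀ with h | h
    · rw [abs_sub_comm]
      refine (lin_aux N N₀ h hN₀).trans ?_
      have := mul_nonneg hδ.le (hB0 N₀); linarith
    · refine (lin_aux N₀ N h hN).trans ?_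
      have := mul_nonneg hδ.le (hB0 N); linarith
  -- the noise and mixed terms at `N` and at `N₀`
  have atN : ∑ k ∈ freqs N, ‖θ k * z k + η k‖ ^ 2
      + (1 + 5 * δ) * ∑ k ∈ freqs N, (1 - L * a k) * (‖η k‖ ^ 2 - s * a k
          + 2 * (θ k * z k * conj (η k)).re + ‖θ k * z k‖ ^ 2)
      ≤ ∑ k ∈ freqs N, (1 + 3 * δ + (1 + 5 * δ) * (1 - L * a k)) * (‖η k‖ ^ 2 - s * a k)
        + (1 + 3 * δ) * (s * ∑ k ∈ freqs N, a k)
        + 6 * δ⁻¹ * ∑ k ∈ freqs N, ‖θ k * z k‖ ^ 2 := by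
    rw [Finset.mul_sum, Finset.mul_sum, Finset.mul_sum, Finset.mul_sum, ← Finset.sum_add_distrib,
      ← Finset.sum_add_distrib, ← Finset.sum_add_distrib]
    refine Finset.sum_le_sum fun k hk => ?_
    have hkm : k ∈ freqs m := freqs_mono hN hk
    have hr0 : 0 ≤ 1 - L * a k := by linarith [hLa k hkm]
    have hr1 : 1 - L * a k ≤ 1 := by nlinarith [mul_nonneg hL (ha k)]
    have hc := two_mul_re_mul_conj_le hδ (θ k * z k) (η k)
    have e : ‖θ k * z k + η k‖ ^ 2
        = ‖θ k * z k‖ ^ 2 + 2 * (θ k * z k * conj (η k)).re + ‖η k‖ ^ 2 := by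
      simp only [← Complex.normSq_eq_norm_sq, Complex.normSq_add]; ring
    rw [e]
    set r := 1 - L * a k
    set X := ‖θ k * z k‖ ^ 2
    set Y := ‖η k‖ ^ 2
    set Z := 2 * (θ k * z k * conj (η k)).re
    have hX : 0 ≤ X := sq_nonneg _
    have hY : 0 ≤ Y := sq_nonneg _
    have hq0 : 0 ≤ (1 + 5 * δ) * r := by positivity
    -- The cross term occurs once in the loss and (1 + 5δ) r times in the criterion. Its share
    -- 3δ|η|² is recentred at s a_k, hence the 3δ in the weight and in the variance term.
    have hq : 1 + (1 + 5 * δ) * r ≤ 3 := by nlinarith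
    have hW0 : 0 ≤ δ * Y + δ⁻¹ * X := by positivity
    have h1 : (1 + (1 + 5 * δ) * r) * Z ≤ 3 * (δ * Y + δ⁻¹ * X) := by
      calc (1 + (1 + 5 * δ) * r) * Z ≤ (1 + (1 + 5 * δ) * r) * (δ * Y + δ⁻¹ * X) :=
            mul_le_mul_of_nonneg_left ((le_abs_self _).trans hc) (by linarith)
        _ ≤ _ := mul_le_mul_of_nonneg_right hq hW0
    have h2 : (1 + (1 + 5 * δ) * r) * X ≤ 3 * (δ⁻¹ * X) := by
      calc (1 + (1 + 5 * δ) * r) * X ≤ 3 * X := mul_le_mul_of_nonneg_right hq hX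
        _ ≤ 3 * (δ⁻¹ * X) := by nlinarith
    nlinarith
  have atN₀ : -((1 + 5 * δ) * ∑ k ∈ freqs N₀, (1 - L * a k) * (‖η k‖ ^ 2 - s * a k
          + 2 * (θ k * z k * conj (η k)).re + ‖θ k * z k‖ ^ 2))
      ≤ ∑ k ∈ freqs N₀, (2 * δ - (1 + 5 * δ) * (1 - L * a k)) * (‖η k‖ ^ 2 - s * a k)
        + 2 * δ * (s * ∑ k ∈ freqs N₀, a k) + 2 * δ⁻¹ * ∑ k ∈ freqs N₀, ‖θ k * z k‖ ^ 2 := by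
    rw [Finset.mul_sum, Finset.mul_sum, Finset.mul_sum, Finset.mul_sum, ← Finset.sum_neg_distrib,
      ← Finset.sum_add_distrib, ← Finset.sum_add_distrib]
    refine Finset.sum_le_sum fun k hk => ?_
    have hkm : k ∈ freqs m := freqs_mono hN₀ hk
    have hr0 : 0 ≤ 1 - L * a k := by linarith [hLa k hkm]
    have hr1 : 1 - L * a k ≤ 1 := by nlinarith [mul_nonneg hL (ha k)]
    have hc := two_mul_re_mul_conj_le hδ (θ k * z k) (η k)
    set r := 1 - L * a k
    set X := ‖θ k * z k‖ ^ 2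
    set Y := ‖η k‖ ^ 2
    set Z := 2 * (θ k * z k * conj (η k)).re
    have hX : 0 ≤ X := sq_nonneg _
    have hY : 0 ≤ Y := sq_nonneg _
    have hq0 : 0 ≤ (1 + 5 * δ) * r := by positivity
    have hq : (1 + 5 * δ) * r ≤ 2 := by nlinarith
    have hW0 : 0 ≤ δ * Y + δ⁻¹ * X := by positivity
    have h1 : (1 + 5 * δ) * r * (-Z) ≤ 2 * (δ * Y + δ⁻¹ * X) := by
      calc (1 + 5 * δ) * r * (-Z) ≤ (1 + 5 * δ) * r * (δ * Y + δ⁻¹ * X) :=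
            mul_le_mul_of_nonneg_left ((neg_le_abs _).trans hc) hq0
        _ ≤ _ := mul_le_mul_of_nonneg_right hq hW0
    -- At the competitor the squared shift term has the favourable sign and is dropped.
    have h2 : 0 ≤ (1 + 5 * δ) * r * X := mul_nonneg hq0 hX
    nlinarith
  rw [split N, split N₀] at hU
  have eN := hBΘ N hN
  have eN₀ := hBΘ N₀ hN₀
  have qN := quad N hN
  have qN₀ := quad N₀ hN₀
  have lin' := (le_abs_self _).trans lin
  have hSN : 0 ≤ s * ∑ k ∈ freqs N, a k := mul_nonneg hs (Finset.sum_nonneg fun k _ => ha k)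
  have hSN₀ : 0 ≤ s * ∑ k ∈ freqs N₀, a k := mul_nonneg hs (Finset.sum_nonneg fun k _ => ha k)
  have hTN : 0 ≤ L * ∑ k ∈ freqs N, a k * ‖θ k‖ ^ 2 :=
    mul_nonneg hL (Finset.sum_nonneg fun k _ => mul_nonneg (ha k) (sq_nonneg _))
  have hTN₀ : 0 ≤ L * ∑ k ∈ freqs N₀, a k * ‖θ k‖ ^ 2 :=
    mul_nonneg hL (Finset.sum_nonneg fun k _ => mul_nonneg (ha k) (sq_nonneg _))
  have hBN := hB0 N
  have hBN₀ := hB0 N₀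
  set SN := s * ∑ k ∈ freqs N, a k
  set SN₀ := s * ∑ k ∈ freqs N₀, a k
  set TN := L * ∑ k ∈ freqs N, a k * ‖θ k‖ ^ 2
  set TN₀ := L * ∑ k ∈ freqs N₀, a k * ‖θ k‖ ^ 2
  set ZN := ∑ k ∈ freqs N, (1 - L * a k) * (2 * ‖θ k‖ ^ 2 * (z k).re)
  set ZN₀ := ∑ k ∈ freqs N₀, (1 - L * a k) * (2 * ‖θ k‖ ^ 2 * (z k).re)
  set RN := ∑ k ∈ freqs N, (1 - L * a k) * (θ k * conj (η k)).re
  set RN₀ := ∑ k ∈ freqs N₀, (1 - L * a k) * (θ k * conj (η k)).re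
  set XN := ∑ k ∈ freqs N, ‖θ k * z k‖ ^ 2
  set XN₀ := ∑ k ∈ freqs N₀, ‖θ k * z k‖ ^ 2
  have x1 : 6 * δ⁻¹ * XN ≤ 6 * δ * TN + 6 * δ⁻¹ * Q := by
    calc 6 * δ⁻¹ * XN ≤ 6 * δ⁻¹ * (δ ^ 2 * TN + Q) := by gcongr
      _ = _ := by field_simp
  have x2 : 2 * δ⁻¹ * XN₀ ≤ 2 * δ * TN₀ + 2 * δ⁻¹ * Q := by
    calc 2 * δ⁻¹ * XN₀ ≤ 2 * δ⁻¹ * (δ ^ 2 * TN₀ + Q) := by gcongr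
      _ = _ := by field_simp
  have x3 : (1 + 5 * δ) * (ZN - ZN₀) ≤ 4 * δ * (B N + B N₀) + 2 * (δ⁻¹ * Q) := by
    have h0 : 0 ≤ 2 * δ * (B N + B N₀) + δ⁻¹ * Q := by positivity
    calc (1 + 5 * δ) * (ZN - ZN₀) ≤ (1 + 5 * δ) * (2 * δ * (B N + B N₀) + δ⁻¹ * Q) :=
          mul_le_mul_of_nonneg_left lin' (by positivity)
      _ ≤ 2 * (2 * δ * (B N + B N₀) + δ⁻¹ * Q) :=
          mul_le_mul_of_nonneg_right (by linarith) h0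
      _ = _ := by ring
  have x4 : (1 + 5 * δ) * (2 * (RN - RN₀)) ≤ G + δ * (B N + B N₀ + SN + SN₀) := by
    refine le_trans ?_ hG
    have := le_abs_self (RN - RN₀)
    have h0 := abs_nonneg (RN - RN₀)
    calc (1 + 5 * δ) * (2 * (RN - RN₀)) ≤ (1 + 5 * δ) * (2 * |RN - RN₀|) := by gcongr
      _ ≤ 2 * (2 * |RN - RN₀|) := by gcongr; linarith
      _ = _ := by ring
  -- The factor 1 + 5δ leaves slack at N: the tail energy pays 4δ (shifts) and δ (linear noise), the
  -- variance pays 3δ (cross term), δ (quadratic noise) and δ (linear noise). The penalty at N pays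
  -- 6δ, which is where δ ≤ 1/6 enters.
  have hU' := mul_le_mul_of_nonneg_left hU (by positivity : (0 : ℝ) ≤ 1 + 5 * δ)
  have x5 : 6 * δ * TN ≤ TN := by nlinarith
  have x6 : 0 ≤ δ * TN₀ := by positivity
  have x7 : 0 ≤ δ * TN := by positivity
  have x8 : 0 ≤ δ * SN₀ := by positivity
  have eN' : ∑ k ∈ freqs N, ‖θ k‖ ^ 2 = B N₀ + ∑ k ∈ freqs N₀, ‖θ k‖ ^ 2 - B N := by linarith
  rw [eN'] at hU'
  linarith

end

/-! ### Integrals against Brownian paths as limits of Riemann sums -/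

section

/-- The integral `∫_0^1 φ dw`, defined by integration by parts. -/
noncomputable def stieltjes (φ w : ℝ → ℝ) : ℝ :=
  φ 1 * w 1 - φ 0 * w 0 - ∫ x in (0 : ℝ)..1, deriv φ x * w x

/-- The Riemann sum of `∫_0^1 φ dw` over the regular partition of `[0, 1]` in `m` intervals. -/
noncomputable def riemannSum (φ w : ℝ → ℝ) (m : ℕ) : ℝ :=
  ∑ i ∈ Finset.range m, φ (i / m) * (w ((i + 1 : ℕ) / m) - w (i / m))

theorem ceil_eq_on_grid {m i : ℕ} (hm : 0 < m) {x : ℝ} (hx : x ∈ Ioc ((i : ℝ) / m) ((i + 1 : ℕ) / m)) :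
    ⌈(m : ℝ) * x⌉₊ = i + 1 := by
  have hm' : (0 : ℝ) < m := by exact_mod_cast hm
  rw [Nat.ceil_eq_iff (by omega)]
  obtain ⟨h1, h2⟩ := hx
  rw [div_lt_iff₀ hm'] at h1
  rw [le_div_iff₀ hm'] at h2
  rw [Nat.add_sub_cancel]
  push_cast at h2 ⊢
  constructor <;> linarith

/-- Summation by parts. Increments weighted by the left value of φ leave w at the right endpoint, so
rounding up to the grid makes the integration by parts formula exact. -/
theorem riemannSum_eq {φ w : ℝ → ℝ} (hφ : ContDiff ℝ 1 φ) {m : ℕ} (hm : 0 < m) :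
    riemannSum φ w m = φ 1 * w 1 - φ 0 * w 0
      - ∫ x in (0 : ℝ)..1, deriv φ x * w ((⌈(m : ℝ) * x⌉₊ : ℝ) / m) := by
  have hm' : (0 : ℝ) < m := by exact_mod_cast hm
  have hφ' : Continuous (deriv φ) := hφ.continuous_deriv le_rfl
  have hle : ∀ i : ℕ, (i : ℝ) / m ≤ (i + 1 : ℕ) / m := fun i => by
    gcongr; exact_mod_cast Nat.le_succ i
  have piece : ∀ i : ℕ, ∫ x in ((i : ℝ) / m)..((i + 1 : ℕ) / m),
      deriv φ x * w ((⌈(m : ℝ) * x⌉₊ : ℝ) / m)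
      = (φ ((i + 1 : ℕ) / m) - φ (i / m)) * w ((i + 1 : ℕ) / m) := by
    intro i
    have e : ∫ x in ((i : ℝ) / m)..((i + 1 : ℕ) / m), deriv φ x * w ((⌈(m : ℝ) * x⌉₊ : ℝ) / m)
        = ∫ x in ((i : ℝ) / m)..((i + 1 : ℕ) / m), deriv φ x * w ((i + 1 : ℕ) / m) := by
      refine intervalIntegral.integral_congr_ae (ae_of_all _ fun x hx => ?_)
      rw [uIoc_of_le (hle i)] at hx
      simp only [ceil_eq_on_grid hm hx]
    rw [e, intervalIntegral.integral_mul_const, intervalIntegral.integral_deriv_eq_sub]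
    · exact fun x _ => (hφ.differentiable (by norm_num)).differentiableAt
    · exact hφ'.intervalIntegrable _ _
  have hint : ∀ i < m, IntervalIntegrable (fun x => deriv φ x * w ((⌈(m : ℝ) * x⌉₊ : ℝ) / m))
      volume ((i : ℝ) / m) ((i + 1 : ℕ) / m) := by
    intro i _
    have h1 : IntervalIntegrable (fun x => deriv φ x * w ((i + 1 : ℕ) / m)) volume
        ((i : ℝ) / m) ((i + 1 : ℕ) / m) := (hφ'.mul continuous_const).intervalIntegrable _ _
    refine h1.congr (fun x hx => ?_)
    rw [uIoc_of_le (hle i)] at hx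
    simp only [ceil_eq_on_grid hm hx]
  have hs := intervalIntegral.sum_integral_adjacent_intervals (a := fun i : ℕ => (i : ℝ) / m)
    (f := fun x => deriv φ x * w ((⌈(m : ℝ) * x⌉₊ : ℝ) / m)) (μ := volume) hint
  simp only [Nat.cast_zero, zero_div, div_self hm'.ne'] at hs
  rw [← hs, riemannSum]
  have ht := Finset.sum_range_sub (fun i : ℕ => φ ((i : ℝ) / m) * w (i / m)) m
  simp only [Nat.cast_zero, zero_div, div_self hm'.ne'] at ht
  rw [← ht, ← Finset.sum_sub_distrib]
  refine Finset.sum_congr rfl fun i _ => ?_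
  rw [piece]
  ring

theorem tendsto_riemannSum {φ w : ℝ → ℝ} (hφ : ContDiff ℝ 1 φ) (hw : Continuous w) :
    Tendsto (riemannSum φ w) atTop (𝓝 (stieltjes φ w)) := by
  have hφ' : Continuous (deriv φ) := hφ.continuous_deriv le_rfl
  obtain ⟨C, hC⟩ := (isCompact_Icc (a := (0 : ℝ)) (b := 1)).exists_bound_of_continuousOn
    hφ'.continuousOn
  obtain ⟨D, hD⟩ := (isCompact_Icc (a := (0 : ℝ)) (b := 1)).exists_bound_of_continuousOn
    hw.continuousOn
  have hlim : Tendsto (fun m : ℕ => ∫ x in (0 : ℝ)..1,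
      deriv φ x * w ((⌈(m : ℝ) * x⌉₊ : ℝ) / m)) atTop
      (𝓝 (∫ x in (0 : ℝ)..1, deriv φ x * w x)) := by
    refine intervalIntegral.tendsto_integral_filter_of_dominated_convergence (fun _ => C * D)
      ?_ ?_ (by simp) ?_
    · refine Eventually.of_forall fun m => ?_
      have : Measurable fun x : ℝ => deriv φ x * w ((⌈(m : ℝ) * x⌉₊ : ℝ) / m) := by
        refine hφ'.measurable.mul (hw.measurable.comp (Measurable.div_const ?_ _))
        exact (measurable_from_nat (f := fun n : ℕ => (n : ℝ))).comp
          (Nat.measurable_ceil.comp (measurable_const.mul measurable_id))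
      exact this.aestronglyMeasurable
    · filter_upwards [eventually_gt_atTop 0] with m hm
      refine ae_of_all _ fun x hx => ?_
      have hm' : (0 : ℝ) < m := by exact_mod_cast hm
      rw [uIoc_of_le zero_le_one] at hx
      rw [norm_mul]
      have h1 := hC x ⟨hx.1.le, hx.2⟩
      refine mul_le_mul h1 (hD _ ⟨by positivity, ?_⟩) (norm_nonneg _) ((norm_nonneg _).trans h1)
      rw [div_le_one hm']
      have : ⌈(m : ℝ) * x⌉₊ ≤ m := Nat.ceil_le.2 (by nlinarith [hx.2])
      exact_mod_cast this
    · refine ae_of_all _ fun x hx => ?_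
      rw [uIoc_of_le zero_le_one] at hx
      refine tendsto_const_nhds.mul ((hw.tendsto x).comp ?_)
      have h := (tendsto_nat_ceil_mul_div_atTop hx.1.le).comp (tendsto_natCast_atTop_atTop (R := ℝ))
      refine h.congr fun m => ?_
      simp [mul_comm]
  have h2 := (tendsto_const_nhds (x := φ 1 * w 1 - φ 0 * w 0)).sub hlim
  refine h2.congr' ?_
  filter_upwards [eventually_gt_atTop 0] with m hm
  rw [riemannSum_eq hφ hm]

theorem stieltjes_id {ψ : ℝ → ℝ} (hψ : ContDiff ℝ 1 ψ) :
    stieltjes ψ (fun x => x) = ∫ x in (0 : ℝ)..1, ψ x := by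
  have h := intervalIntegral.integral_deriv_mul_eq_sub (a := 0) (b := 1) (u := ψ) (v := fun x => x)
    (u' := deriv ψ) (v' := fun _ => 1)
    (fun x _ => (hψ.differentiable (by norm_num)).differentiableAt.hasDerivAt)
    (fun x _ => hasDerivAt_id' x) ((hψ.continuous_deriv le_rfl).intervalIntegrable _ _)
    (by simp)
  rw [intervalIntegral.integral_add] at h
  · simp only [mul_one] at h
    simp only [stieltjes]
    linarith
  · exact ((hψ.continuous_deriv le_rfl).mul continuous_id).intervalIntegrable _ _
  · exact (hψ.continuous.mul continuous_const).intervalIntegrable _ _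

/-- The case w(x) = x of the preceding convergence; used to pass to the limit in the variances. -/
theorem tendsto_riemann_average {ψ : ℝ → ℝ} (hψ : ContDiff ℝ 1 ψ) :
    Tendsto (fun m : ℕ => ∑ i ∈ Finset.range m, ψ (i / m) * (m : ℝ)⁻¹) atTop
      (𝓝 (∫ x in (0 : ℝ)..1, ψ x)) := by
  rw [← stieltjes_id hψ]
  refine (tendsto_riemannSum hψ continuous_id).congr fun m => ?_
  refine Finset.sum_congr rfl fun i _ => ?_
  simp only [id_eq]
  push_cast
  ring

variable {Ω : Type*} [MeasurableSpace Ω] {μ : Measure Ω}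

/-- The path on `ℝ` of a process indexed by `ℝ≥0`. -/
def path (w : ℝ≥0 → ℝ) (x : ℝ) : ℝ := w x.toNNReal

/-- The increments over the grid are independent centred Gaussians of variance 1/m, so the
characteristic function is a product. -/
theorem charFun_riemannSum_brownian [IsProbabilityMeasure μ] {W : ℝ≥0 → Ω → ℝ}
    (hW : IsPreBrownianReal W μ) (φ : ℝ → ℝ) {m : ℕ} (hm : 0 < m) (t : ℝ) :
    charFun (μ.map fun ω => riemannSum φ (path fun s => W s ω) m) t
      = Complex.exp (-((∑ i ∈ Finset.range m, φ (i / m) ^ 2 * (m : ℝ)⁻¹) * t ^ 2 / 2 : ℝ)) := by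
  have hm' : (0 : ℝ) < m := by exact_mod_cast hm
  set T : ℕ → ℝ≥0 := fun i => (i : ℝ≥0) / m with hT
  have hTm : Monotone T := fun i j hij => by
    simp only [hT]; gcongr
  have hind := hW.hasIndepIncrements.nat hTm
  have hTr : ∀ i : ℕ, ((i : ℝ) / m).toNNReal = T i := by
    intro i
    rw [← NNReal.coe_inj, Real.coe_toNNReal _ (by positivity)]
    simp [hT]
  have e : (fun ω => riemannSum φ (path fun s => W s ω) m)
      = fun ω => ∑ i ∈ Finset.range m, φ (i / m) * (W (T (i + 1)) ω - W (T i) ω) := by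
    funext ω
    simp only [riemannSum, path, hTr]
  have hind' : iIndepFun (fun (i : ℕ) ω => φ (i / m) * (W (T (i + 1)) ω - W (T i) ω)) μ :=
    hind.comp (fun i x => φ (i / m) * x) (fun i => measurable_const.mul measurable_id)
  have hae : ∀ i : ℕ, AEMeasurable (fun ω => W (T (i + 1)) ω - W (T i) ω) μ :=
    fun i => (hW.aemeasurable _).sub (hW.aemeasurable _)
  rw [e, iIndepFun.charFun_map_fun_finsetSum_eq_prod (fun i _ => (hae i).const_mul _)
    (hind'.restrict _), Finset.prod_apply]
  have hlaw : ∀ i : ℕ, charFun (μ.map fun ω => φ (i / m) * (W (T (i + 1)) ω - W (T i) ω)) t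
      = Complex.exp (-((φ (i / m) ^ 2 * (m : ℝ)⁻¹) * t ^ 2 / 2 : ℝ)) := by
    intro i
    have h1 : μ.map (fun ω => W (T (i + 1)) ω - W (T i) ω) = gaussianReal 0 ((m : ℝ≥0)⁻¹) := by
      have h2 := (hW.hasLaw_sub (T (i + 1)) (T i)).map_eq
      have h3 : nndist (T (i + 1)).1 (T i).1 = (m : ℝ≥0)⁻¹ := by
        rw [← NNReal.coe_inj, coe_nndist, Real.dist_eq]
        simp only [hT, NNReal.val_eq_coe]
        push_cast
        rw [← sub_div, add_sub_cancel_left, abs_of_nonneg (by positivity), one_div]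
      rw [h3] at h2
      exact h2
    have h4 := charFun_map_mul_comp (hae i) (φ (i / m)) t
    rw [h4, h1, charFun_gaussianReal]
    push_cast
    congr 1
    ring
  simp_rw [hlaw]
  rw [← Complex.exp_sum]
  congr 1
  push_cast
  rw [Finset.sum_mul, Finset.sum_div, Finset.sum_neg_distrib]

end

/-! ### The noise coefficients are independent standard Gaussians -/

section

/-- The functions `cos (2 π k x) + sin (2 π k x)`, which form an orthonormal family. -/
noncomputable def cas (k : ℤ) (x : ℝ) : ℝ :=
  Real.cos (2 * Real.pi * k * x) + Real.sin (2 * Real.pi * k * x)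

theorem contDiff_cas (k : ℤ) : ContDiff ℝ 1 (cas k) := by
  unfold cas
  fun_prop

theorem integral_cos_two_pi (k : ℤ) :
    ∫ x in (0 : ℝ)..1, Real.cos (2 * Real.pi * k * x) = if k = 0 then 1 else 0 := by
  split_ifs with h
  · simp [h]
  · have hk : (2 * Real.pi * k : ℝ) ≠ 0 := by
      have : (k : ℝ) ≠ 0 := by exact_mod_cast h
      positivity
    rw [intervalIntegral.integral_comp_mul_left (fun x => Real.cos x) hk, integral_cos]
    have : Real.sin (2 * Real.pi * k * 1) = 0 := by
      rw [show 2 * Real.pi * k * 1 = ((2 * k : ℤ) : ℝ) * Real.pi by push_cast; ring]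
      exact Real.sin_int_mul_pi _
    rw [this]
    simp

theorem integral_sin_two_pi (k : ℤ) :
    ∫ x in (0 : ℝ)..1, Real.sin (2 * Real.pi * k * x) = 0 := by
  by_cases h : k = 0
  · simp [h]
  · have hk : (2 * Real.pi * k : ℝ) ≠ 0 := by
      have : (k : ℝ) ≠ 0 := by exact_mod_cast h
      positivity
    rw [intervalIntegral.integral_comp_mul_left (fun x => Real.sin x) hk, integral_sin]
    have : Real.cos (2 * Real.pi * k * 1) = 1 := by
      rw [show 2 * Real.pi * k * 1 = (k : ℝ) * (2 * Real.pi) by ring]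
      exact Real.cos_int_mul_two_pi _
    rw [this]
    simp

theorem integral_cas_mul_cas (k l : ℤ) :
    ∫ x in (0 : ℝ)..1, cas k x * cas l x = if k = l then 1 else 0 := by
  have e : ∀ x, cas k x * cas l x
      = Real.cos (2 * Real.pi * (k - l : ℤ) * x) + Real.sin (2 * Real.pi * (k + l : ℤ) * x) := by
    intro x
    have h1 : (2 * Real.pi * (k - l : ℤ) * x)
        = 2 * Real.pi * k * x - 2 * Real.pi * l * x := by push_cast; ring
    have h2 : (2 * Real.pi * (k + l : ℤ) * x)
        = 2 * Real.pi * k * x + 2 * Real.pi * l * x := by push_cast; ring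
    rw [h1, h2, Real.cos_sub, Real.sin_add]
    simp only [cas]
    ring
  simp_rw [e]
  rw [intervalIntegral.integral_add, integral_cos_two_pi, integral_sin_two_pi, add_zero]
  · simp [sub_eq_zero]
  · exact Continuous.intervalIntegrable (by fun_prop) _ _
  · exact Continuous.intervalIntegrable (by fun_prop) _ _

theorem integral_sum_cas_sq (F : Finset ℤ) (t : ℤ → ℝ) :
    ∫ x in (0 : ℝ)..1, (∑ k ∈ F, t k * cas k x) ^ 2 = ∑ k ∈ F, t k ^ 2 := by
  have hc : ∀ k, Continuous (cas k) := fun k => (contDiff_cas k).continuous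
  have e : ∀ x, (∑ k ∈ F, t k * cas k x) ^ 2
      = ∑ k ∈ F, ∑ l ∈ F, t k * t l * (cas k x * cas l x) := by
    intro x
    rw [sq, Finset.sum_mul_sum]
    refine Finset.sum_congr rfl fun k _ => Finset.sum_congr rfl fun l _ => by ring
  simp_rw [e]
  rw [intervalIntegral.integral_finsetSum]
  · refine Finset.sum_congr rfl fun k hk => ?_
    rw [intervalIntegral.integral_finsetSum]
    · simp_rw [intervalIntegral.integral_const_mul, integral_cas_mul_cas]
      simp [hk, sq]
    · exact fun l _ => (continuous_const.mul ((hc k).mul (hc l))).intervalIntegrable _ _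
  · intro k _
    refine Continuous.intervalIntegrable ?_ _ _
    exact continuous_finsetSum _ fun l _ => continuous_const.mul ((hc k).mul (hc l))

theorem stieltjes_const_mul (c : ℝ) (φ w : ℝ → ℝ) :
    stieltjes (fun x => c * φ x) w = c * stieltjes φ w := by
  simp only [stieltjes, deriv_const_mul_field', mul_assoc]
  rw [intervalIntegral.integral_const_mul]
  ring

theorem stieltjes_sum {ι : Type*} (F : Finset ι) {φ : ι → ℝ → ℝ} (hφ : ∀ k, ContDiff ℝ 1 (φ k))
    {w : ℝ → ℝ} (hw : Continuous w) :
    stieltjes (fun x => ∑ k ∈ F, φ k x) w = ∑ k ∈ F, stieltjes (φ k) w := by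
  have hd : ∀ x, deriv (fun x => ∑ k ∈ F, φ k x) x = ∑ k ∈ F, deriv (φ k) x := fun x =>
    deriv_fun_sum fun k _ => ((hφ k).differentiable (by norm_num)).differentiableAt
  simp only [stieltjes, hd, Finset.sum_mul]
  rw [intervalIntegral.integral_finsetSum]
  · rw [Finset.sum_sub_distrib, Finset.sum_sub_distrib]
  · exact fun k _ => (((hφ k).continuous_deriv le_rfl).mul hw).intervalIntegrable _ _

theorem continuous_path {w : ℝ≥0 → ℝ} (hw : Continuous w) : Continuous (path w) :=
  hw.comp continuous_real_toNNReal

variable {Ω : Type*} [MeasurableSpace Ω] {μ : Measure Ω}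

/-- `n` independent Brownian motions. -/
structure IsNoise {n : ℕ} (W : Fin n → ℝ≥0 → Ω → ℝ) (μ : Measure Ω) : Prop where
  measurable : ∀ j t, Measurable (W j t)
  brownian : ∀ j, IsBrownianReal (W j) μ
  indep : iIndepFun (fun j ω t => W j t ω) μ

variable {n : ℕ} {W : Fin n → ℝ≥0 → Ω → ℝ}

theorem measurable_riemannSum_path (φ : ℝ → ℝ) (m : ℕ) :
    Measurable fun w : ℝ≥0 → ℝ => riemannSum φ (path w) m := by
  unfold riemannSum path
  fun_prop

theorem IsNoise.measurable_riemannSum (hW : IsNoise W μ) (φ : ℝ → ℝ) (m : ℕ) (j : Fin n) :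
    Measurable fun ω => riemannSum φ (path fun t => W j t ω) m :=
  (measurable_riemannSum_path φ m).comp (measurable_pi_lambda _ fun t => hW.measurable j t)

theorem IsNoise.integral_exp_sum_riemannSum [IsProbabilityMeasure μ] (hW : IsNoise W μ)
    (φ : ℝ → ℝ) {m : ℕ} (hm : 0 < m) :
    ∫ ω, Complex.exp ((∑ j, riemannSum φ (path fun t => W j t ω) m : ℝ) * Complex.I) ∂μ
      = Complex.exp (-(n * (∑ i ∈ Finset.range m, φ (i / m) ^ 2 * (m : ℝ)⁻¹) / 2 : ℝ)) := by
  have hind : iIndepFun (fun j ω => riemannSum φ (path fun t => W j t ω) m) μ :=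
    hW.indep.comp (fun _ w => riemannSum φ (path w) m)
      (fun _ => measurable_riemannSum_path φ m)
  have hmeas : ∀ j, AEMeasurable (fun ω => riemannSum φ (path fun t => W j t ω) m) μ :=
    fun j => (hW.measurable_riemannSum φ m j).aemeasurable
  have h := congrFun (hind.charFun_map_fun_sum_eq_prod hmeas) 1
  rw [charFun_apply_real, integral_map (by fun_prop) (by fun_prop), Finset.prod_apply] at h
  simp_rw [charFun_riemannSum_brownian (hW.brownian _).toIsPreBrownianReal φ hm] at h
  rw [Finset.prod_const, ← Complex.exp_nat_mul] at h
  simp only [Complex.ofReal_one, one_mul] at h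
  rw [h]
  congr 1
  push_cast
  simp
  ring

theorem IsNoise.ae_continuous (hW : IsNoise W μ) :
    ∀ᵐ ω ∂μ, ∀ j, Continuous (path fun t => W j t ω) := by
  rw [ae_all_iff]
  intro j
  filter_upwards [(hW.brownian j).cont] with ω h using continuous_path h

theorem IsNoise.aemeasurable_stieltjes (hW : IsNoise W μ) {φ : ℝ → ℝ} (hφ : ContDiff ℝ 1 φ)
    (j : Fin n) : AEMeasurable (fun ω => stieltjes φ (path fun t => W j t ω)) μ := by
  refine aemeasurable_of_tendsto_metrizable_ae atTop
    (f := fun m ω => riemannSum φ (path fun t => W j t ω) m)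
    (fun m => (hW.measurable_riemannSum φ m j).aemeasurable) ?_
  filter_upwards [hW.ae_continuous] with ω h using tendsto_riemannSum hφ (h j)

theorem IsNoise.integral_exp_sum_stieltjes [IsProbabilityMeasure μ] (hW : IsNoise W μ)
    {φ : ℝ → ℝ} (hφ : ContDiff ℝ 1 φ) :
    ∫ ω, Complex.exp ((∑ j, stieltjes φ (path fun t => W j t ω) : ℝ) * Complex.I) ∂μ
      = Complex.exp (-(n * (∫ x in (0 : ℝ)..1, φ x ^ 2) / 2 : ℝ)) := by
  have h1 : Tendsto (fun m : ℕ => ∫ ω,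
      Complex.exp ((∑ j, riemannSum φ (path fun t => W j t ω) m : ℝ) * Complex.I) ∂μ) atTop
      (𝓝 (∫ ω, Complex.exp ((∑ j, stieltjes φ (path fun t => W j t ω) : ℝ) * Complex.I) ∂μ)) := by
    refine tendsto_integral_of_dominated_convergence (fun _ => 1) ?_ (integrable_const _) ?_ ?_
    · intro m
      have : Measurable fun ω => ∑ j, riemannSum φ (path fun t => W j t ω) m :=
        Finset.measurable_fun_sum _ fun j _ => hW.measurable_riemannSum φ m j
      exact Measurable.aestronglyMeasurable (by fun_prop)
    · exact fun m => ae_of_all _ fun ω => (Complex.norm_exp_ofReal_mul_I _).le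
    · filter_upwards [hW.ae_continuous] with ω h
      have h2 : Tendsto (fun m => ∑ j, riemannSum φ (path fun t => W j t ω) m) atTop
          (𝓝 (∑ j, stieltjes φ (path fun t => W j t ω))) :=
        tendsto_finsetSum _ fun j _ => tendsto_riemannSum hφ (h j)
      have hc : Continuous fun x : ℝ => Complex.exp ((x : ℂ) * Complex.I) := by fun_prop
      exact (hc.tendsto _).comp h2
  have h2 : Tendsto (fun m : ℕ => Complex.exp
      (-(n * (∑ i ∈ Finset.range m, φ (i / m) ^ 2 * (m : ℝ)⁻¹) / 2 : ℝ))) atTop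
      (𝓝 (Complex.exp (-(n * (∫ x in (0 : ℝ)..1, φ x ^ 2) / 2 : ℝ)))) := by
    have hc : Continuous fun x : ℝ => Complex.exp (-(n * x / 2 : ℝ)) := by fun_prop
    exact (hc.tendsto _).comp (tendsto_riemann_average (hφ.pow 2))
  refine tendsto_nhds_unique h1 (h2.congr' ?_)
  filter_upwards [eventually_gt_atTop 0] with m hm
  exact (hW.integral_exp_sum_riemannSum φ hm).symm

/-- The coefficients of the averaged noise in the orthonormal family `cas`. -/
noncomputable def noiseCoeff (W : Fin n → ℝ≥0 → Ω → ℝ) (k : ℤ) (ω : Ω) : ℝ :=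
  (√n)⁻¹ * ∑ j, stieltjes (cas k) (path fun t => W j t ω)

theorem IsNoise.aemeasurable_noiseCoeff (hW : IsNoise W μ) (k : ℤ) :
    AEMeasurable (noiseCoeff W k) μ :=
  (Finset.aemeasurable_fun_sum _ fun j _ =>
    hW.aemeasurable_stieltjes (contDiff_cas k) j).const_mul _

/-- By linearity the combination is the integral of the single function ∑ t_k cas_k, whose squared
norm is ∑ t_k² by orthonormality. This joint characteristic function yields both the marginals and
the independence. -/
theorem IsNoise.integral_exp_noiseCoeff [IsProbabilityMeasure μ] (hW : IsNoise W μ) (hn : 0 < n)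
    (F : Finset ℤ) (t : ℤ → ℝ) :
    ∫ ω, Complex.exp ((∑ k ∈ F, t k * noiseCoeff W k ω : ℝ) * Complex.I) ∂μ
      = Complex.exp (-((∑ k ∈ F, t k ^ 2) / 2 : ℝ)) := by
  have hn' : (0 : ℝ) < n := by exact_mod_cast hn
  have hcd : ∀ k, ContDiff ℝ 1 fun x => (√n)⁻¹ * t k * cas k x := fun k =>
    contDiff_const.mul (contDiff_cas k)
  have h := hW.integral_exp_sum_stieltjes (ContDiff.sum (s := F) fun k _ => hcd k)
  have e : ∫ x in (0 : ℝ)..1, (∑ k ∈ F, (√n)⁻¹ * t k * cas k x) ^ 2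
      = (n : ℝ)⁻¹ * ∑ k ∈ F, t k ^ 2 := by
    rw [integral_sum_cas_sq F fun k => (√n)⁻¹ * t k, Finset.mul_sum]
    refine Finset.sum_congr rfl fun k _ => ?_
    rw [mul_pow, inv_pow, Real.sq_sqrt hn'.le]
  rw [e, mul_inv_cancel_left₀ hn'.ne'] at h
  rw [← h]
  refine integral_congr_ae ?_
  filter_upwards [hW.ae_continuous] with ω hω
  congr 3
  simp only [noiseCoeff, Finset.mul_sum]
  rw [Finset.sum_comm]
  refine Finset.sum_congr rfl fun j _ => ?_
  rw [stieltjes_sum F hcd (hω j)]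
  refine Finset.sum_congr rfl fun k _ => ?_
  rw [stieltjes_const_mul]
  ring

theorem IsNoise.map_noiseCoeff [IsProbabilityMeasure μ] (hW : IsNoise W μ) (hn : 0 < n) (k : ℤ) :
    μ.map (noiseCoeff W k) = gaussianReal 0 1 := by
  have := hW.aemeasurable_noiseCoeff k
  have : IsProbabilityMeasure (μ.map (noiseCoeff W k)) := Measure.isProbabilityMeasure_map this
  refine Measure.ext_of_charFun ?_
  ext t
  rw [charFun_apply_real, integral_map (by fun_prop) (by fun_prop), charFun_gaussianReal]
  have h := hW.integral_exp_noiseCoeff hn {k} fun _ => t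
  simp only [Finset.sum_singleton, Complex.ofReal_mul] at h
  rw [h]
  congr 1
  push_cast
  ring

theorem IsNoise.iIndepFun_noiseCoeff [IsProbabilityMeasure μ] (hW : IsNoise W μ) (hn : 0 < n) :
    iIndepFun (noiseCoeff W) μ := by
  rw [iIndepFun_iff_finset]
  intro F
  rw [iIndepFun_iff_charFun_pi (X := F.restrict (noiseCoeff W))
    fun k => hW.aemeasurable_noiseCoeff k]
  intro t
  have hm : ∀ k, AEMeasurable (noiseCoeff W k) μ := hW.aemeasurable_noiseCoeff
  have hm' : AEMeasurable (fun ω => WithLp.toLp 2 fun k : F => F.restrict (noiseCoeff W) k ω) μ :=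
    (WithLp.measurable_toLp 2 _).comp_aemeasurable
      (aemeasurable_pi_lambda _ fun k : F => hm k)
  rw [charFun_apply, integral_map hm' (by fun_prop)]
  -- Extension by zero, since the joint formula takes arguments indexed by all of ℤ.
  set t' : ℤ → ℝ := fun k => if h : k ∈ F then t ⟨k, h⟩ else 0 with ht'
  have h := hW.integral_exp_noiseCoeff hn F t'
  have e : ∀ ω, ∑ k ∈ F, t' k * noiseCoeff W k ω
      = inner ℝ (WithLp.toLp 2 fun k : F => F.restrict (noiseCoeff W) k ω) t := by
    intro ω
    rw [← Finset.sum_coe_sort F]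
    simp [PiLp.inner_apply, ht']
  simp_rw [e] at h
  rw [h]
  have e2 : ∀ k : F, charFun (μ.map (F.restrict (noiseCoeff W) k)) (t k)
      = Complex.exp (-((t' k ^ 2) / 2 : ℝ)) := by
    intro k
    simp only [Finset.restrict]
    rw [hW.map_noiseCoeff hn, charFun_gaussianReal]
    simp [ht']
  simp_rw [e2]
  rw [← Complex.exp_sum, Finset.sum_coe_sort F fun k => -(((t' k ^ 2) / 2 : ℝ) : ℂ)]
  congr 1
  push_cast
  rw [Finset.sum_neg_distrib, Finset.sum_div]

end

/-! ### Exponential inequalities for Gaussian linear and quadratic forms -/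

section

open scoped ComplexConjugate

variable {Ω : Type*} [MeasurableSpace Ω] {μ : Measure Ω}

theorem posPart_le_exp {l : ℝ} (hl : 0 < l) (y t : ℝ) :
    max (y - t) 0 ≤ l⁻¹ * Real.exp (-(l * t)) * Real.exp (l * y) := by
  rw [mul_assoc, ← Real.exp_add, max_le_iff]
  refine ⟨?_, by positivity⟩
  rw [← div_eq_inv_mul, le_div_iff₀ hl]
  have := Real.add_one_le_exp (-(l * t) + l * y)
  linarith

theorem integrable_posPart_of_exp [IsProbabilityMeasure μ] {Y : Ω → ℝ} (hY : AEMeasurable Y μ)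
    {l : ℝ} (hl : 0 < l) (t : ℝ) (hint : Integrable (fun ω => Real.exp (l * Y ω)) μ) :
    Integrable (fun ω => max (Y ω - t) 0) μ := by
  refine (hint.const_mul (l⁻¹ * Real.exp (-(l * t)))).mono' ?_ (ae_of_all _ fun ω => ?_)
  · exact ((hY.sub_const t).max aemeasurable_const).aestronglyMeasurable
  · rw [Real.norm_of_nonneg (le_max_right _ _)]
    exact posPart_le_exp hl _ _

theorem integral_posPart_le_mgf {Y : Ω → ℝ}
    {l : ℝ} (hl : 0 < l) (t : ℝ) (hint : Integrable (fun ω => Real.exp (l * Y ω)) μ) :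
    ∫ ω, max (Y ω - t) 0 ∂μ ≤ l⁻¹ * Real.exp (-(l * t)) * mgf Y μ l := by
  rw [mgf, ← integral_const_mul]
  exact integral_mono_of_nonneg (ae_of_all _ fun ω => le_max_right _ _) (hint.const_mul _)
    (ae_of_all _ fun ω => posPart_le_exp hl _ _)

/-- With x = 2s this bounds the chi-square factor (1 - 2s)^(-1/2) by exp(s + 2s²); the first-order
part cancels against the centring. -/
theorem one_le_one_sub_mul_exp {x : ℝ} (hx : |x| ≤ 1 / 2) :
    1 ≤ (1 - x) * Real.exp (x + x ^ 2) := by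
  obtain ⟨h1, h2⟩ := abs_le.1 hx
  rcases le_total 0 x with h | h
  · have := Real.quadratic_le_exp_of_nonneg (by positivity : 0 ≤ x + x ^ 2)
    have h3 : 0 ≤ x ^ 2 * (1 - x - x ^ 2 - x ^ 3) := by
      have : x ^ 2 ≤ 1 / 4 := by nlinarith
      have : x ^ 3 ≤ 1 / 8 := by nlinarith [sq_nonneg x]
      exact mul_nonneg (sq_nonneg _) (by linarith)
    calc 1 ≤ (1 - x) * (1 + (x + x ^ 2) + (x + x ^ 2) ^ 2 / 2) := by nlinarith
      _ ≤ _ := by gcongr; linarith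
  · have := Real.add_one_le_exp (x + x ^ 2)
    have h3 : x ^ 3 ≤ 0 := by nlinarith [sq_nonneg x]
    calc 1 ≤ (1 - x) * (x + x ^ 2 + 1) := by nlinarith
      _ ≤ _ := by gcongr; linarith

theorem mgf_sq_sub_one_gaussian {s : ℝ} (hs : |s| ≤ 1 / 4) :
    0 < mgf (fun x => x ^ 2 - 1) (gaussianReal 0 1) s ∧
      mgf (fun x => x ^ 2 - 1) (gaussianReal 0 1) s ≤ Real.exp (2 * s ^ 2) := by
  obtain ⟨h1, h2⟩ := abs_le.1 hs
  have hb : 0 < 1 / 2 - s := by linarith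
  have e : mgf (fun x => x ^ 2 - 1) (gaussianReal 0 1) s = Real.exp (-s) * √(1 / (1 - 2 * s)) := by
    rw [mgf, integral_gaussianReal_eq_integral_smul one_ne_zero]
    have e1 : ∀ x : ℝ, gaussianPDFReal 0 1 x • Real.exp (s * (x ^ 2 - 1))
        = ((√(2 * Real.pi))⁻¹ * Real.exp (-s)) * Real.exp (-(1 / 2 - s) * x ^ 2) := by
      intro x
      simp only [gaussianPDFReal, smul_eq_mul, NNReal.coe_one, mul_one, sub_zero]
      rw [mul_assoc, ← Real.exp_add, mul_assoc, ← Real.exp_add]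
      congr 2
      ring
    simp_rw [e1]
    rw [integral_const_mul, integral_gaussian, mul_comm (√(2 * Real.pi))⁻¹, mul_assoc,
      ← Real.sqrt_inv, ← Real.sqrt_mul (by positivity)]
    congr 2
    have := Real.pi_pos
    field_simp
  rw [e]
  have hp : 0 < 1 - 2 * s := by linarith
  refine ⟨by positivity, ?_⟩
  have hx := one_le_one_sub_mul_exp (x := 2 * s) (by rw [abs_mul, abs_two]; linarith)
  have h3 : √(1 / (1 - 2 * s)) ≤ Real.exp (s + 2 * s ^ 2) := by
    rw [Real.sqrt_le_left (by positivity), ← Real.exp_nat_mul, div_le_iff₀ hp]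
    refine hx.trans_eq ?_
    rw [mul_comm]
    congr 2
    push_cast
    ring
  calc _ ≤ Real.exp (-s) * Real.exp (s + 2 * s ^ 2) := by gcongr
    _ = _ := by rw [← Real.exp_add]; congr 1; ring

/-- A family of independent standard Gaussian variables. -/
structure IsStdGaussianFamily (X : ℤ → Ω → ℝ) (μ : Measure Ω) : Prop where
  aemeasurable : ∀ k, AEMeasurable (X k) μ
  map_eq : ∀ k, μ.map (X k) = gaussianReal 0 1
  indep : iIndepFun X μ

variable {X : ℤ → Ω → ℝ}

theorem IsStdGaussianFamily.mgf_sum_sq (hX : IsStdGaussianFamily X μ) (F : Finset ℤ) {b : ℤ → ℝ}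
    {l : ℝ} (hb : ∀ k ∈ F, |l * b k| ≤ 1 / 4) :
    Integrable (fun ω => Real.exp (l * ∑ k ∈ F, b k * (X k ω ^ 2 - 1))) μ ∧
      mgf (fun ω => ∑ k ∈ F, b k * (X k ω ^ 2 - 1)) μ l
        ≤ Real.exp (2 * l ^ 2 * ∑ k ∈ F, b k ^ 2) := by
  have : IsProbabilityMeasure μ := hX.indep.isProbabilityMeasure
  have hm := hX.aemeasurable
  have hind : iIndepFun (fun k ω => b k * (X k ω ^ 2 - 1)) μ :=
    hX.indep.comp (fun k x => b k * (x ^ 2 - 1)) fun k => by fun_prop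
  have h := hind.mgf_sum₀ (t := l) (fun k => by fun_prop) F
  have hfun : (∑ k ∈ F, fun ω => b k * (X k ω ^ 2 - 1))
      = fun ω => ∑ k ∈ F, b k * (X k ω ^ 2 - 1) := by ext ω; simp
  rw [hfun] at h
  have h1 : ∀ k, mgf (fun ω => b k * (X k ω ^ 2 - 1)) μ l
      = mgf (fun x => x ^ 2 - 1) (gaussianReal 0 1) (l * b k) := by
    intro k
    rw [← hX.map_eq k, mgf, mgf, integral_map (hm k) (by fun_prop)]
    simp only [mul_assoc]
  simp_rw [h1] at h
  have hpos : 0 < mgf (fun ω => ∑ k ∈ F, b k * (X k ω ^ 2 - 1)) μ l := by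
    rw [h]
    exact Finset.prod_pos fun k hk => (mgf_sq_sub_one_gaussian (hb k hk)).1
  refine ⟨mgf_pos_iff.1 hpos, ?_⟩
  rw [h, Finset.mul_sum, Real.exp_sum]
  refine Finset.prod_le_prod (fun k hk => (mgf_sq_sub_one_gaussian (hb k hk)).1.le) fun k hk => ?_
  refine (mgf_sq_sub_one_gaussian (hb k hk)).2.trans_eq ?_
  congr 1
  ring

theorem IsStdGaussianFamily.mgf_sum_mul (hX : IsStdGaussianFamily X μ) (F : Finset ℤ) (b : ℤ → ℝ)
    (l : ℝ) :
    Integrable (fun ω => Real.exp (l * ∑ k ∈ F, b k * X k ω)) μ ∧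
      mgf (fun ω => ∑ k ∈ F, b k * X k ω) μ l = Real.exp (l ^ 2 * (∑ k ∈ F, b k ^ 2) / 2) := by
  have : IsProbabilityMeasure μ := hX.indep.isProbabilityMeasure
  have hm := hX.aemeasurable
  have hind : iIndepFun (fun k ω => b k * X k ω) μ :=
    hX.indep.comp (fun k x => b k * x) fun k => by fun_prop
  have h := hind.mgf_sum₀ (t := l) (fun k => by fun_prop) F
  have hfun : (∑ k ∈ F, fun ω => b k * X k ω)
      = fun ω => ∑ k ∈ F, b k * X k ω := by ext ω; simp
  rw [hfun] at h
  have h1 : ∀ k, mgf (fun ω => b k * X k ω) μ l = Real.exp ((l * b k) ^ 2 / 2) := by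
    intro k
    have h2 := mgf_gaussianReal (hX.map_eq k) (l * b k)
    rw [mgf] at h2 ⊢
    simp only [mul_assoc] at h2 ⊢
    rw [h2]
    simp
  simp_rw [h1] at h
  have e : mgf (fun ω => ∑ k ∈ F, b k * X k ω) μ l
      = Real.exp (l ^ 2 * (∑ k ∈ F, b k ^ 2) / 2) := by
    rw [h, ← Real.exp_sum, Finset.mul_sum, Finset.sum_div]
    congr 1
    exact Finset.sum_congr rfl fun k _ => by ring
  exact ⟨mgf_pos_iff.1 (by rw [e]; positivity), e⟩

/-- The complex Gaussian variables with real and imaginary parts `(X_k + X_{-k}) / 2` and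
`-(X_k - X_{-k}) / 2`. -/
noncomputable def complexNoise (X : ℤ → Ω → ℝ) (ω : Ω) (k : ℤ) : ℂ :=
  ⟨(X k ω + X (-k) ω) / 2, -((X k ω - X (-k) ω) / 2)⟩

theorem norm_complexNoise_sq {Ω : Type*} (X : ℤ → Ω → ℝ) (ω : Ω) (k : ℤ) :
    ‖complexNoise X ω k‖ ^ 2 = (X k ω ^ 2 + X (-k) ω ^ 2) / 2 := by
  rw [← Complex.normSq_eq_norm_sq, Complex.normSq_apply]
  simp only [complexNoise]
  ring

theorem sum_symm {F : Finset ℤ} (hF : ∀ k ∈ F, -k ∈ F) (u : ℤ → ℝ) :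
    ∑ k ∈ F, u (-k) = ∑ k ∈ F, u k :=
  Finset.sum_nbij' (fun k => -k) (fun k => -k) hF hF (by simp) (by simp) (by simp)

theorem neg_mem_freqs {N : ℕ} : ∀ k ∈ freqs N, -k ∈ freqs N := by
  intro k hk
  rw [mem_freqs] at *
  simpa using hk

theorem neg_mem_freqs_sdiff {N M : ℕ} : ∀ k ∈ freqs M \ freqs N, -k ∈ freqs M \ freqs N := by
  intro k hk
  rw [Finset.mem_sdiff, mem_freqs, mem_freqs] at *
  simpa using hk

/-- The complex noises at k and -k are conjugate, hence dependent. Symmetrising the weights rewrites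
the form in the independent real variables. -/
theorem sum_mul_norm_complexNoise {Ω : Type*} {X : ℤ → Ω → ℝ} {F : Finset ℤ} (hF : ∀ k ∈ F, -k ∈ F) (b : ℤ → ℝ)
    (ω : Ω) :
    ∑ k ∈ F, b k * (‖complexNoise X ω k‖ ^ 2 - 1)
      = ∑ k ∈ F, (b k + b (-k)) / 2 * (X k ω ^ 2 - 1) := by
  have h := sum_symm hF fun k => b (-k) * (X k ω ^ 2 - 1) / 2
  simp only [neg_neg] at h
  have e1 : ∀ k, b k * (‖complexNoise X ω k‖ ^ 2 - 1)
      = b k * (X k ω ^ 2 - 1) / 2 + b k * (X (-k) ω ^ 2 - 1) / 2 := by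
    intro k; rw [norm_complexNoise_sq]; ring
  simp_rw [e1]
  rw [Finset.sum_add_distrib, h, ← Finset.sum_add_distrib]
  exact Finset.sum_congr rfl fun k _ => by ring

theorem sum_re_mul_conj_complexNoise {Ω : Type*} {X : ℤ → Ω → ℝ} {F : Finset ℤ} (hF : ∀ k ∈ F, -k ∈ F) (h : ℤ → ℂ)
    (ω : Ω) :
    ∑ k ∈ F, (h k * conj (complexNoise X ω k)).re
      = ∑ k ∈ F, ((h k).re - (h k).im + ((h (-k)).re + (h (-k)).im)) / 2 * X k ω := by
  have hs := sum_symm hF fun k => ((h (-k)).re + (h (-k)).im) / 2 * X k ω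
  simp only [neg_neg] at hs
  have e1 : ∀ k, (h k * conj (complexNoise X ω k)).re
      = ((h k).re - (h k).im) / 2 * X k ω + ((h k).re + (h k).im) / 2 * X (-k) ω := by
    intro k
    simp only [complexNoise, Complex.mul_re, Complex.conj_re, Complex.conj_im]
    ring
  simp_rw [e1]
  rw [Finset.sum_add_distrib, hs, ← Finset.sum_add_distrib]
  exact Finset.sum_congr rfl fun k _ => by ring

theorem IsStdGaussianFamily.quadratic_excess (hX : IsStdGaussianFamily X μ) {N : ℕ}
    {a b : ℤ → ℝ} {amax δ : ℝ} (hδ : 0 < δ) (hδ1 : δ ≤ 1) (hamax : 0 < amax)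
    (ha0 : ∀ k, 0 ≤ a k) (ha : ∀ k ∈ freqs N, a k ≤ amax) (hb : ∀ k ∈ freqs N, |b k| ≤ 4 * a k) :
    Integrable (fun ω => max (∑ k ∈ freqs N, b k * (‖complexNoise X ω k‖ ^ 2 - 1)
      - δ * ∑ k ∈ freqs N, a k) 0) μ ∧
    ∫ ω, max (∑ k ∈ freqs N, b k * (‖complexNoise X ω k‖ ^ 2 - 1)
      - δ * ∑ k ∈ freqs N, a k) 0 ∂μ
      ≤ 64 * amax / δ * Real.exp (-(δ ^ 2 * (∑ k ∈ freqs N, a k) / (128 * amax))) := by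
  have : IsProbabilityMeasure μ := hX.indep.isProbabilityMeasure
  have hm := hX.aemeasurable
  simp_rw [sum_mul_norm_complexNoise (X := X) neg_mem_freqs b]
  -- Then the second-order term 2l² · 16 amax · S equals half of lδS, leaving the exponent -lδS/2;
  -- also 4 l amax = δ/16 stays in the range allowed by `mgf_sum_sq`.
  set l := δ / (64 * amax) with hl
  have hl0 : 0 < l := by positivity
  have hb' : ∀ k ∈ freqs N, |(b k + b (-k)) / 2| ≤ 4 * ((a k + a (-k)) / 2) := by
    intro k hk
    have h1 := hb k hk
    have h2 := hb (-k) (neg_mem_freqs k hk)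
    rw [abs_div, abs_two]
    have := abs_add_le (b k) (b (-k))
    linarith
  have ha' : ∀ k ∈ freqs N, (a k + a (-k)) / 2 ≤ amax := by
    intro k hk
    have h1 := ha k hk
    have h2 := ha (-k) (neg_mem_freqs k hk)
    linarith
  obtain ⟨hi, hmgf⟩ := hX.mgf_sum_sq (freqs N) (b := fun k => (b k + b (-k)) / 2) (l := l) (by
    intro k hk
    rw [abs_mul, abs_of_pos hl0]
    calc l * |(b k + b (-k)) / 2| ≤ l * (4 * amax) := by
          gcongr; exact (hb' k hk).trans (by linarith [ha' k hk])
      _ = δ / 16 := by rw [hl]; field_simp; norm_num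
      _ ≤ 1 / 4 := by linarith)
  refine ⟨integrable_posPart_of_exp (by fun_prop) hl0 _ hi, ?_⟩
  refine (integral_posPart_le_mgf hl0 _ hi).trans ?_
  set S := ∑ k ∈ freqs N, a k with hS
  have hsq : ∑ k ∈ freqs N, ((b k + b (-k)) / 2) ^ 2 ≤ 16 * amax * S := by
    have e : S = ∑ k ∈ freqs N, (a k + a (-k)) / 2 := by
      rw [← Finset.sum_div, Finset.sum_add_distrib, sum_symm neg_mem_freqs a]; ring
    rw [e, Finset.mul_sum]
    refine Finset.sum_le_sum fun k hk => ?_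
    have h0 : 0 ≤ (a k + a (-k)) / 2 := by have := ha0 k; have := ha0 (-k); linarith
    rw [← sq_abs]
    calc |(b k + b (-k)) / 2| ^ 2 ≤ (4 * ((a k + a (-k)) / 2)) ^ 2 := by
          gcongr; exact hb' k hk
      _ = 16 * ((a k + a (-k)) / 2) * ((a k + a (-k)) / 2) := by ring
      _ ≤ 16 * amax * ((a k + a (-k)) / 2) := by gcongr; exact ha' k hk
  calc l⁻¹ * Real.exp (-(l * (δ * S)))
        * mgf (fun ω => ∑ k ∈ freqs N, (b k + b (-k)) / 2 * (X k ω ^ 2 - 1)) μ l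
      ≤ l⁻¹ * Real.exp (-(l * (δ * S))) * Real.exp (2 * l ^ 2 * (16 * amax * S)) := by
        gcongr
        exact hmgf.trans (by gcongr)
    _ = 64 * amax / δ * Real.exp (-(δ ^ 2 * S / (128 * amax))) := by
        rw [mul_assoc, ← Real.exp_add]
        congr 1
        · rw [hl]; field_simp
        · congr 1
          rw [hl]; field_simp; ring

/-- The form is a centred real Gaussian of variance at most 2∑‖h k‖². The absolute value is split
into its two signs, whence the factor 2. -/
theorem IsStdGaussianFamily.linear_excess (hX : IsStdGaussianFamily X μ) {F : Finset ℤ}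
    (hF : ∀ k ∈ F, -k ∈ F) (h : ℤ → ℂ) {l : ℝ} (hl : 0 < l) (t : ℝ) :
    Integrable (fun ω => max (|∑ k ∈ F, (h k * conj (complexNoise X ω k)).re| - t) 0) μ ∧
    ∫ ω, max (|∑ k ∈ F, (h k * conj (complexNoise X ω k)).re| - t) 0 ∂μ
      ≤ 2 * l⁻¹ * Real.exp (l ^ 2 * (∑ k ∈ F, ‖h k‖ ^ 2) - l * t) := by
  have : IsProbabilityMeasure μ := hX.indep.isProbabilityMeasure
  have hm := hX.aemeasurable
  simp_rw [sum_re_mul_conj_complexNoise (X := X) hF h]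
  set c : ℤ → ℝ := fun k => ((h k).re - (h k).im + ((h (-k)).re + (h (-k)).im)) / 2 with hc
  have hsq : ∑ k ∈ F, c k ^ 2 ≤ 2 * ∑ k ∈ F, ‖h k‖ ^ 2 := by
    have e : 2 * ∑ k ∈ F, ‖h k‖ ^ 2 = ∑ k ∈ F, (‖h k‖ ^ 2 + ‖h (-k)‖ ^ 2) := by
      rw [Finset.sum_add_distrib, sum_symm hF fun k => ‖h k‖ ^ 2]; ring
    rw [e]
    refine Finset.sum_le_sum fun k _ => ?_
    simp only [hc, ← Complex.normSq_eq_norm_sq, Complex.normSq_apply]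
    nlinarith [sq_nonneg ((h k).re + (h k).im), sq_nonneg ((h (-k)).re - (h (-k)).im),
      sq_nonneg ((h k).re - (h k).im - ((h (-k)).re + (h (-k)).im))]
  have main : ∀ s : ℝ, s ^ 2 = 1 →
      Integrable (fun ω => max (s * ∑ k ∈ F, c k * X k ω - t) 0) μ ∧
      ∫ ω, max (s * ∑ k ∈ F, c k * X k ω - t) 0 ∂μ
        ≤ l⁻¹ * Real.exp (l ^ 2 * (∑ k ∈ F, ‖h k‖ ^ 2) - l * t) := by
    intro s hs
    obtain ⟨hi, hmgf⟩ := hX.mgf_sum_mul F (fun k => s * c k) l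
    simp only [mul_assoc] at hi hmgf
    simp only [← Finset.mul_sum, mul_pow, hs, one_mul] at hi hmgf
    refine ⟨integrable_posPart_of_exp (by fun_prop) hl _ hi, ?_⟩
    refine (integral_posPart_le_mgf hl _ hi).trans ?_
    rw [hmgf, mul_assoc, ← Real.exp_add]
    gcongr
    nlinarith [mul_le_mul_of_nonneg_left hsq (sq_nonneg l)]
  obtain ⟨i1, b1⟩ := main 1 (by norm_num)
  obtain ⟨i2, b2⟩ := main (-1) (by norm_num)
  have hle : ∀ ω, max (|∑ k ∈ F, c k * X k ω| - t) 0
      ≤ max (1 * ∑ k ∈ F, c k * X k ω - t) 0 + max (-1 * ∑ k ∈ F, c k * X k ω - t) 0 := by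
    intro ω
    have p1 := le_max_right (1 * ∑ k ∈ F, c k * X k ω - t) 0
    have p2 := le_max_right (-1 * ∑ k ∈ F, c k * X k ω - t) 0
    have p3 := le_max_left (1 * ∑ k ∈ F, c k * X k ω - t) 0
    have p4 := le_max_left (-1 * ∑ k ∈ F, c k * X k ω - t) 0
    refine max_le ?_ (by linarith)
    rcases abs_cases (∑ k ∈ F, c k * X k ω) with ⟨e, _⟩ | ⟨e, _⟩ <;> rw [e] <;> linarith
  have hint : Integrable (fun ω => max (|∑ k ∈ F, c k * X k ω| - t) 0) μ := by
    refine (i1.add i2).mono' ?_ (ae_of_all _ fun ω => ?_)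
    · have : AEMeasurable (fun ω => ∑ k ∈ F, c k * X k ω) μ := by fun_prop
      have h2 : AEMeasurable (fun ω => |∑ k ∈ F, c k * X k ω|) μ :=
        continuous_abs.measurable.comp_aemeasurable this
      exact ((h2.sub_const t).max aemeasurable_const).aestronglyMeasurable
    · rw [Real.norm_of_nonneg (le_max_right _ _)]
      exact hle ω
  refine ⟨hint, ?_⟩
  refine (integral_mono hint (i1.add i2) hle).trans ?_
  simp only [Pi.add_apply]
  rw [integral_add i1 i2]
  linarith

end

/-! ### Concentration of the empirical Fourier coefficients of the shifts -/

section

theorem norm_mode (k : ℤ) (x : ℝ) : ‖mode k x‖ = 1 := by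
  rw [mode, ← Complex.ofReal_neg]
  exact Complex.norm_exp_ofReal_mul_I _

theorem continuous_mode (k : ℤ) : Continuous (mode k) := by
  unfold mode
  fun_prop

theorem shiftCoeff_zero {g : ℝ → ℝ} (hg : IsDensity g) : shiftCoeff g 0 = 1 := by
  simp only [shiftCoeff, mode]
  simp only [Int.cast_zero, mul_zero, zero_mul, neg_zero, Complex.ofReal_zero, Complex.exp_zero,
    one_mul]
  rw [integral_complex_ofReal, hg.integral_eq_one, Complex.ofReal_one]

theorem mode_neg (k : ℤ) (x : ℝ) : mode (-k) x = (starRingEnd ℂ) (mode k x) := by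
  simp only [mode, ← Complex.exp_conj]
  congr 1
  rw [map_mul, map_neg, Complex.conj_ofReal, Complex.conj_I]
  push_cast
  ring

theorem norm_shiftCoeff_neg (g : ℝ → ℝ) (k : ℤ) : ‖shiftCoeff g (-k)‖ = ‖shiftCoeff g k‖ := by
  have : shiftCoeff g (-k) = (starRingEnd ℂ) (shiftCoeff g k) := by
    rw [shiftCoeff, shiftCoeff, ← integral_conj]
    refine integral_congr_ae (ae_of_all _ fun x => ?_)
    simp [mode_neg]
  rw [this, RCLike.norm_conj]

variable {Ω : Type*} [MeasurableSpace Ω] {μ : Measure Ω} {g : ℝ → ℝ} {n : ℕ}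
  {τ : Fin n → Ω → ℝ} {W : Fin n → ℝ≥0 → Ω → ℝ}

theorem IsShiftNoise.integral_mode (hS : IsShiftNoise μ g τ W) (hg : IsDensity g) (k : ℤ)
    (j : Fin n) : ∫ ω, mode k (τ j ω) ∂μ = shiftCoeff g k := by
  rw [← integral_map (hS.measurable_shift j).aemeasurable
    (continuous_mode k).aestronglyMeasurable, hS.law_shift,
    integral_withDensity_eq_integral_toReal_smul (by have := hg.measurable; fun_prop)
      (ae_of_all _ fun x => ENNReal.ofReal_lt_top)]
  refine integral_congr_ae (ae_of_all _ fun x => ?_)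
  simp [ENNReal.toReal_ofReal (hg.nonneg x), mul_comm]

theorem IsShiftNoise.hasSubgaussianMGF (hS : IsShiftNoise μ g τ W) {ψ : ℝ → ℝ}
    (hψ : Measurable ψ) (hψ1 : ∀ x, |ψ x| ≤ 1) {e : ℝ} (he : ∀ j, ∫ ω, ψ (τ j ω) ∂μ = e) :
    HasSubgaussianMGF (fun ω => ∑ j, (ψ (τ j ω) - e)) n μ := by
  have : IsProbabilityMeasure μ := hS.indep_shift.isProbabilityMeasure
  have hind : iIndepFun (fun j ω => ψ (τ j ω) - e) μ :=
    hS.indep_shift.comp (fun _ x => ψ x - e) fun _ => hψ.sub_const e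
  have h1 : ∀ j ∈ Finset.univ, HasSubgaussianMGF (fun ω => ψ (τ j ω) - e) 1 μ := by
    intro j _
    have h := hasSubgaussianMGF_of_mem_Icc (μ := μ) (X := fun ω => ψ (τ j ω)) (a := -1) (b := 1)
      (hψ.comp (hS.measurable_shift j)).aemeasurable
      (ae_of_all _ fun ω => abs_le.1 (hψ1 _))
    rw [he] at h
    convert h using 1
    rw [← NNReal.coe_inj]
    norm_num
  have h := HasSubgaussianMGF.sum_of_iIndepFun hind h1
  simpa using h

/-- The excess vanishes unless y > sℓ. There y² ≤ 2 exp y and ℓ ≤ y/s, so a factor exp(-ℓ) can be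
extracted; for ℓ = log n it is the 1/n of the final remainder. -/
theorem sq_excess_le_exp {s ℓ y : ℝ} (hs : 0 < s) (hy : 0 ≤ y) :
    max (y ^ 2 - s ^ 2 * ℓ ^ 2) 0 ≤ 2 * Real.exp (-ℓ) * Real.exp ((1 + s⁻¹) * y) := by
  refine max_le ?_ (by positivity)
  rcases le_total y (s * ℓ) with h | h
  · have : y ^ 2 ≤ (s * ℓ) ^ 2 := pow_le_pow_left₀ hy h 2
    have h2 : 0 ≤ 2 * Real.exp (-ℓ) * Real.exp ((1 + s⁻¹) * y) := by positivity
    nlinarith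
  · have h1 := Real.quadratic_le_exp_of_nonneg hy
    have h2 : ℓ ≤ s⁻¹ * y := by rw [← div_eq_inv_mul, le_div_iff₀ hs]; linarith
    have h3 : Real.exp y ≤ Real.exp (-ℓ) * Real.exp ((1 + s⁻¹) * y) := by
      rw [← Real.exp_add, Real.exp_le_exp]; linarith
    have h4 : 0 ≤ s ^ 2 * ℓ ^ 2 := by positivity
    nlinarith

theorem subgaussian_sq_excess [IsProbabilityMeasure μ] {D : Ω → ℝ} (hn : 0 < n)
    (hD : HasSubgaussianMGF D n μ) {s : ℝ} (hs : 0 < s) :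
    Integrable (fun ω => max ((D ω / √n) ^ 2 - s ^ 2 * Real.log n ^ 2) 0) μ ∧
    ∫ ω, max ((D ω / √n) ^ 2 - s ^ 2 * Real.log n ^ 2) 0 ∂μ
      ≤ 4 * Real.exp ((1 + s⁻¹) ^ 2 / 2) / n := by
  have hn' : (0 : ℝ) < n := by exact_mod_cast hn
  -- At this argument the sub-Gaussian bound exp(n c²/2) no longer depends on n.
  set c := (1 + s⁻¹) / √n with hc
  have hc2 : n * c ^ 2 / 2 = (1 + s⁻¹) ^ 2 / 2 := by
    rw [hc, div_pow, Real.sq_sqrt hn'.le]; field_simp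
  have hle : ∀ ω, max ((D ω / √n) ^ 2 - s ^ 2 * Real.log n ^ 2) 0
      ≤ 2 / n * (Real.exp (c * D ω) + Real.exp (-c * D ω)) := by
    intro ω
    have h := sq_excess_le_exp (ℓ := Real.log n) hs (abs_nonneg (D ω / √n))
    rw [sq_abs] at h
    refine h.trans ?_
    rw [Real.exp_neg, Real.exp_log hn', ← div_eq_mul_inv]
    gcongr
    rw [abs_div, abs_of_nonneg (Real.sqrt_nonneg _)]
    rcases abs_cases (D ω) with ⟨e, _⟩ | ⟨e, _⟩ <;> rw [e]
    · have : (1 + s⁻¹) * (D ω / √n) = c * D ω := by rw [hc]; ring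
      rw [this]
      linarith [Real.exp_pos (-c * D ω)]
    · have : (1 + s⁻¹) * (-D ω / √n) = -c * D ω := by rw [hc]; ring
      rw [this]
      linarith [Real.exp_pos (c * D ω)]
  have i1 := hD.integrable_exp_mul c
  have i2 := hD.integrable_exp_mul (-c)
  have hDm := hD.aemeasurable
  have hint : Integrable (fun ω => 2 / (n : ℝ) * (Real.exp (c * D ω) + Real.exp (-c * D ω))) μ :=
    (i1.add i2).const_mul _
  have hi : Integrable (fun ω => max ((D ω / √n) ^ 2 - s ^ 2 * Real.log n ^ 2) 0) μ := by
    refine hint.mono' ?_ (ae_of_all _ fun ω => ?_)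
    · exact AEMeasurable.aestronglyMeasurable (by fun_prop)
    · rw [Real.norm_of_nonneg (le_max_right _ _)]
      exact hle ω
  refine ⟨hi, (integral_mono hi hint hle).trans ?_⟩
  rw [integral_const_mul, integral_add i1 i2]
  have m1 := hD.mgf_le c
  have m2 := hD.mgf_le (-c)
  simp only [mgf, NNReal.coe_natCast, neg_sq, hc2] at m1 m2
  calc _ ≤ 2 / (n : ℝ) * (Real.exp ((1 + s⁻¹) ^ 2 / 2) + Real.exp ((1 + s⁻¹) ^ 2 / 2)) := by
        gcongr
    _ = _ := by ring

/-- The relative error `γ̃_k / γ_k - 1` of the empirical Fourier coefficients of the shifts. -/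
noncomputable def shiftError (g : ℝ → ℝ) (τ : Fin n → Ω → ℝ) (ω : Ω) (k : ℤ) : ℂ :=
  (1 / (n : ℂ)) * (∑ j, mode k (τ j ω)) / shiftCoeff g k - 1

theorem norm_shiftError_sq {Ω : Type*} {τ : Fin n → Ω → ℝ} (hn : 0 < n) {k : ℤ} (hk : shiftCoeff g k ≠ 0) (ω : Ω) :
    ‖shiftError g τ ω k‖ ^ 2 = (‖shiftCoeff g k‖ ^ 2)⁻¹ / n *
      (((∑ j, ((mode k (τ j ω)).re - (shiftCoeff g k).re)) / √n) ^ 2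
        + ((∑ j, ((mode k (τ j ω)).im - (shiftCoeff g k).im)) / √n) ^ 2) := by
  have hn' : (0 : ℝ) < n := by exact_mod_cast hn
  have hnc : (n : ℂ) ≠ 0 := by exact_mod_cast hn.ne'
  set S : ℂ := ∑ j, (mode k (τ j ω) - shiftCoeff g k) with hSdef
  have e : shiftError g τ ω k = S / (n * shiftCoeff g k) := by
    rw [shiftError, hSdef, Finset.sum_sub_distrib]
    simp only [Finset.sum_const, Finset.card_univ, Fintype.card_fin, nsmul_eq_mul]
    field_simp
  have e1 : ∑ j, ((mode k (τ j ω)).re - (shiftCoeff g k).re) = S.re := by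
    simp [hSdef]
  have e2 : ∑ j, ((mode k (τ j ω)).im - (shiftCoeff g k).im) = S.im := by
    simp [hSdef]
  rw [e, e1, e2, norm_div, norm_mul, Complex.norm_natCast, div_pow, mul_pow, div_pow, div_pow,
    Real.sq_sqrt hn'.le, ← add_div, ← Complex.normSq_eq_norm_sq S, Complex.normSq_apply]
  have : ‖shiftCoeff g k‖ ≠ 0 := norm_ne_zero_iff.2 hk
  field_simp

/-- Real and imaginary parts are treated separately with δ/2 in place of δ, which suffices as
2(δ/2)² ≤ δ². The bound is uniform in k, so it can be summed against |θ_k|². -/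
theorem IsShiftNoise.shift_excess (hS : IsShiftNoise μ g τ W) (hg : IsDensity g) (hn : 2 ≤ n)
    {δ : ℝ} (hδ : 0 < δ) {k : ℤ} (hk : shiftCoeff g k ≠ 0)
    (hLa : Real.log n ^ 2 / n * (‖shiftCoeff g k‖ ^ 2)⁻¹ ≤ 1) :
    Integrable (fun ω => max (‖shiftError g τ ω k‖ ^ 2
      - δ ^ 2 * (Real.log n ^ 2 / n * (‖shiftCoeff g k‖ ^ 2)⁻¹)) 0) μ ∧
    ∫ ω, max (‖shiftError g τ ω k‖ ^ 2
      - δ ^ 2 * (Real.log n ^ 2 / n * (‖shiftCoeff g k‖ ^ 2)⁻¹)) 0 ∂μ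
      ≤ 32 * Real.exp ((1 + (δ / 2)⁻¹) ^ 2 / 2) / n := by
  have : IsProbabilityMeasure μ := hS.indep_shift.isProbabilityMeasure
  have hn0 : 0 < n := by omega
  have hn' : (0 : ℝ) < n := by exact_mod_cast hn0
  have hτ := hS.measurable_shift
  have hmode := (continuous_mode k).measurable
  have hintm : ∀ j, Integrable (fun ω => mode k (τ j ω)) μ := fun j =>
    (integrable_const (1 : ℝ)).mono' (hmode.comp (hτ j)).aestronglyMeasurable
      (ae_of_all _ fun ω => (norm_mode k _).le)
  have hre : ∀ j, ∫ ω, (mode k (τ j ω)).re ∂μ = (shiftCoeff g k).re := fun j => by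
    rw [← hS.integral_mode hg k j]; exact integral_re (hintm j)
  have him : ∀ j, ∫ ω, (mode k (τ j ω)).im ∂μ = (shiftCoeff g k).im := fun j => by
    rw [← hS.integral_mode hg k j]; exact integral_im (hintm j)
  have g1 := hS.hasSubgaussianMGF (ψ := fun x => (mode k x).re) (by fun_prop)
    (fun x => (Complex.abs_re_le_norm _).trans (norm_mode k x).le) hre
  have g2 := hS.hasSubgaussianMGF (ψ := fun x => (mode k x).im) (by fun_prop)
    (fun x => (Complex.abs_im_le_norm _).trans (norm_mode k x).le) him
  have hs : 0 < δ / 2 := by positivity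
  obtain ⟨i1, b1⟩ := subgaussian_sq_excess hn0 g1 hs
  obtain ⟨i2, b2⟩ := subgaussian_sq_excess hn0 g2 hs
  set a := (‖shiftCoeff g k‖ ^ 2)⁻¹ with ha
  have ha0 : 0 < a := by have := norm_pos_iff.2 hk; positivity
  have hlog : 1 / 2 ≤ Real.log n := by
    have h2 : Real.log 2 ≤ Real.log n := Real.log_le_log (by norm_num) (by exact_mod_cast hn)
    have := Real.log_two_gt_d9
    linarith
  -- From L a ≤ 1 and log n ≥ 1/2.
  have han : a / n ≤ 4 := by
    have h1 : Real.log n ^ 2 * (a / n) ≤ 1 := by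
      calc _ = Real.log n ^ 2 / n * a := by ring
        _ ≤ 1 := hLa
    have h2 : (1 / 4 : ℝ) ≤ Real.log n ^ 2 := by nlinarith
    have h3 : 0 < a / n := by positivity
    nlinarith
  simp_rw [norm_shiftError_sq hn0 hk, ← ha]
  set y1 : Ω → ℝ := fun ω => (∑ j, ((mode k (τ j ω)).re - (shiftCoeff g k).re)) / √n with hy1
  set y2 : Ω → ℝ := fun ω => (∑ j, ((mode k (τ j ω)).im - (shiftCoeff g k).im)) / √n with hy2
  have hle : ∀ ω, max (a / n * (y1 ω ^ 2 + y2 ω ^ 2) - δ ^ 2 * (Real.log n ^ 2 / n * a)) 0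
      ≤ 4 * (max (y1 ω ^ 2 - (δ / 2) ^ 2 * Real.log n ^ 2) 0
        + max (y2 ω ^ 2 - (δ / 2) ^ 2 * Real.log n ^ 2) 0) := by
    intro ω
    have p1 := le_max_right (y1 ω ^ 2 - (δ / 2) ^ 2 * Real.log n ^ 2) 0
    have p2 := le_max_right (y2 ω ^ 2 - (δ / 2) ^ 2 * Real.log n ^ 2) 0
    have p3 := le_max_left (y1 ω ^ 2 - (δ / 2) ^ 2 * Real.log n ^ 2) 0
    have p4 := le_max_left (y2 ω ^ 2 - (δ / 2) ^ 2 * Real.log n ^ 2) 0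
    refine max_le ?_ (by linarith)
    calc _ = a / n * (y1 ω ^ 2 + y2 ω ^ 2 - δ ^ 2 * Real.log n ^ 2) := by ring
      _ ≤ a / n * (max (y1 ω ^ 2 - (δ / 2) ^ 2 * Real.log n ^ 2) 0
        + max (y2 ω ^ 2 - (δ / 2) ^ 2 * Real.log n ^ 2) 0) := by
          refine mul_le_mul_of_nonneg_left ?_ (by positivity)
          have : 0 ≤ δ ^ 2 * Real.log n ^ 2 := by positivity
          nlinarith
      _ ≤ _ := mul_le_mul_of_nonneg_right han (by linarith)
  have hint := (i1.add i2).const_mul 4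
  have m1 : Measurable y1 := by fun_prop
  have m2 : Measurable y2 := by fun_prop
  have hi : Integrable (fun ω =>
      max (a / n * (y1 ω ^ 2 + y2 ω ^ 2) - δ ^ 2 * (Real.log n ^ 2 / n * a)) 0) μ := by
    refine hint.mono' (Measurable.aestronglyMeasurable (by fun_prop)) (ae_of_all _ fun ω => ?_)
    rw [Real.norm_of_nonneg (le_max_right _ _)]
    exact hle ω
  refine ⟨hi, (integral_mono hi hint hle).trans ?_⟩
  simp only [Pi.add_apply]
  rw [integral_const_mul, integral_add i1 i2]
  calc _ ≤ 4 * (4 * Real.exp ((1 + (δ / 2)⁻¹) ^ 2 / 2) / n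
        + 4 * Real.exp ((1 + (δ / 2)⁻¹) ^ 2 / 2) / n) := by gcongr
    _ = _ := by ring

end

/-! ### From the observed curves to the sequence model -/

section

/-- The function `cos (2 π k x)`. -/
noncomputable def cosMode (k : ℤ) (x : ℝ) : ℝ := Real.cos (2 * Real.pi * k * x)

/-- The function `sin (2 π k x)`. -/
noncomputable def sinMode (k : ℤ) (x : ℝ) : ℝ := Real.sin (2 * Real.pi * k * x)

theorem contDiff_cosMode (k : ℤ) : ContDiff ℝ 1 (cosMode k) := by
  unfold cosMode
  fun_prop

theorem contDiff_sinMode (k : ℤ) : ContDiff ℝ 1 (sinMode k) := by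
  unfold sinMode
  fun_prop

theorem mode_eq (k : ℤ) (x : ℝ) : mode k x = cosMode k x - sinMode k x * Complex.I := by
  rw [mode, ← Complex.ofReal_neg, Complex.exp_mul_I, ← Complex.ofReal_cos, ← Complex.ofReal_sin,
    Real.cos_neg, Real.sin_neg, cosMode, sinMode]
  push_cast
  ring

theorem deriv_mode (k : ℤ) (x : ℝ) :
    deriv (mode k) x = deriv (cosMode k) x - deriv (sinMode k) x * Complex.I := by
  have hc := ((contDiff_cosMode k).differentiable (by norm_num)).differentiableAt (x := x)
  have hs := ((contDiff_sinMode k).differentiable (by norm_num)).differentiableAt (x := x)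
  have h := hc.hasDerivAt.ofReal_comp.sub (hs.hasDerivAt.ofReal_comp.mul_const Complex.I)
  rw [← h.deriv]
  congr 1
  funext y
  exact mode_eq k y

theorem intervalIntegrable_deriv_mul {φ Y : ℝ → ℝ} (hφ : ContDiff ℝ 1 φ)
    (hY : ContinuousOn Y (Icc 0 1)) :
    IntervalIntegrable (fun x => deriv φ x * Y x) volume 0 1 := by
  refine ContinuousOn.intervalIntegrable ?_
  rw [uIcc_of_le zero_le_one]
  exact (hφ.continuous_deriv le_rfl).continuousOn.mul hY

theorem intervalIntegrable_ofReal {h : ℝ → ℝ} {a b : ℝ} (hh : IntervalIntegrable h volume a b) :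
    IntervalIntegrable (fun x => (h x : ℂ)) volume a b :=
  ⟨hh.1.ofReal, hh.2.ofReal⟩

theorem pathIntegral_mode (k : ℤ) {Y : ℝ → ℝ} (hY : ContinuousOn Y (Icc 0 1)) :
    pathIntegral (mode k) Y = stieltjes (cosMode k) Y - stieltjes (sinMode k) Y * Complex.I := by
  have e : ∀ x, deriv (mode k) x * (Y x : ℂ)
      = ((deriv (cosMode k) x * Y x : ℝ) : ℂ)
        - ((deriv (sinMode k) x * Y x : ℝ) : ℂ) * Complex.I := by
    intro x
    rw [deriv_mode]
    push_cast
    ring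
  have ic := intervalIntegrable_ofReal (intervalIntegrable_deriv_mul (contDiff_cosMode k) hY)
  have is := intervalIntegrable_ofReal (intervalIntegrable_deriv_mul (contDiff_sinMode k) hY)
  rw [pathIntegral]
  simp_rw [e]
  rw [intervalIntegral.integral_sub ic (is.mul_const _), intervalIntegral.integral_mul_const,
    intervalIntegral.integral_ofReal, intervalIntegral.integral_ofReal, mode_eq, mode_eq,
    stieltjes, stieltjes]
  push_cast
  ring

theorem stieltjes_add_const_mul {φ F w : ℝ → ℝ} (hφ : ContDiff ℝ 1 φ)
    (hF : ContinuousOn F (Icc 0 1)) (hw : ContinuousOn w (Icc 0 1)) (ε : ℝ) :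
    stieltjes φ (fun x => F x + ε * w x) = stieltjes φ F + ε * stieltjes φ w := by
  have e : ∀ x, deriv φ x * (F x + ε * w x) = deriv φ x * F x + ε * (deriv φ x * w x) := by
    intro x; ring
  simp only [stieltjes, e]
  rw [intervalIntegral.integral_add (intervalIntegrable_deriv_mul hφ hF)
    ((intervalIntegrable_deriv_mul hφ hw).const_mul _), intervalIntegral.integral_const_mul]
  ring

/-- The primitive of an integrable function is only absolutely continuous, so integration by parts
is used in that class. -/
theorem stieltjes_primitive {φ h : ℝ → ℝ} (hφ : ContDiff ℝ 1 φ)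
    (hh : IntervalIntegrable h volume 0 1) :
    stieltjes φ (fun x => ∫ u in (0 : ℝ)..x, h u) = ∫ x in (0 : ℝ)..1, φ x * h x := by
  have h0 : (0 : ℝ) ∈ uIcc (0 : ℝ) 1 := left_mem_uIcc
  have hac := hh.absolutelyContinuousOnInterval_intervalIntegral h0
  have hφac : AbsolutelyContinuousOnInterval φ 0 1 :=
    hφ.contDiffOn.absolutelyContinuousOnInterval
  rw [stieltjes, ← hφac.integral_mul_deriv_eq_deriv_mul hac]
  refine intervalIntegral.integral_congr_ae ?_
  filter_upwards [hh.ae_hasDerivAt_integral] with x hx hx'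
  rw [(hx (uIoc_subset_uIcc hx') 0 h0).deriv]

theorem cosMode_eq_cas (k : ℤ) (x : ℝ) : cosMode k x = 1 / 2 * cas k x + 1 / 2 * cas (-k) x := by
  simp only [cosMode, cas]
  push_cast
  rw [show 2 * Real.pi * (-(k : ℝ)) * x = -(2 * Real.pi * k * x) by ring, Real.cos_neg,
    Real.sin_neg]
  ring

theorem sinMode_eq_cas (k : ℤ) (x : ℝ) :
    sinMode k x = 1 / 2 * cas k x + -1 / 2 * cas (-k) x := by
  simp only [sinMode, cas]
  push_cast
  rw [show 2 * Real.pi * (-(k : ℝ)) * x = -(2 * Real.pi * k * x) by ring, Real.cos_neg,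
    Real.sin_neg]
  ring

theorem stieltjes_add {φ ψ w : ℝ → ℝ} (hφ : ContDiff ℝ 1 φ) (hψ : ContDiff ℝ 1 ψ)
    (hw : Continuous w) (c d : ℝ) :
    stieltjes (fun x => c * φ x + d * ψ x) w = c * stieltjes φ w + d * stieltjes ψ w := by
  have h := stieltjes_sum (Finset.univ : Finset (Fin 2))
    (φ := fun i x => ![c, d] i * ![φ, ψ] i x)
    (fun i => by fin_cases i <;> exact contDiff_const.mul (by assumption)) hw
  simp only [Fin.sum_univ_two, stieltjes_const_mul] at h
  simpa using h

theorem IsTemplate.intervalIntegrable {f : ℝ → ℝ} (hf : IsTemplate f) (a b : ℝ) :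
    IntervalIntegrable f volume a b := by
  refine hf.periodic.intervalIntegrable₀ one_ne_zero ?_ a b
  rw [intervalIntegrable_iff_integrableOn_Ioc_of_le zero_le_one]
  have : IsFiniteMeasure (volume.restrict (Ioc (0 : ℝ) 1)) := by infer_instance
  exact hf.memLp.integrable (by norm_num)

theorem periodic_mode (k : ℤ) : Function.Periodic (mode k) 1 := by
  intro x
  rw [mode, mode, Complex.exp_eq_exp_iff_exists_int]
  refine ⟨-k, ?_⟩
  push_cast
  ring

theorem mode_add (k : ℤ) (x y : ℝ) : mode k (x + y) = mode k x * mode k y := by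
  rw [mode, mode, mode, ← Complex.exp_add]
  congr 1
  push_cast
  ring

theorem IsTemplate.integral_mode_mul_shift {f : ℝ → ℝ} (hf : IsTemplate f) (k : ℤ) (t : ℝ) :
    ∫ x in (0 : ℝ)..1, mode k x * (f (x - t) : ℂ) = mode k t * templateCoeff f k := by
  have h1 : ∫ x in (0 : ℝ)..1, mode k x * (f (x - t) : ℂ)
      = ∫ x in (0 : ℝ)..1, (fun y => mode k t * (mode k y * (f y : ℂ))) (x - t) := by
    refine intervalIntegral.integral_congr fun x _ => ?_
    simp only
    rw [← mul_assoc, ← mode_add, add_sub_cancel]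
  rw [h1, intervalIntegral.integral_comp_sub_right (fun y => mode k t * (mode k y * (f y : ℂ))) t,
    intervalIntegral.integral_const_mul, templateCoeff]
  congr 1
  have hp : Function.Periodic (fun y => mode k y * (f y : ℂ)) 1 := by
    intro y
    simp only
    rw [periodic_mode k y, hf.periodic y]
  have h2 := hp.intervalIntegral_add_eq (0 - t) 0
  rw [zero_add] at h2
  rw [← h2]
  congr 1
  ring

theorem pathIntegral_curve {f : ℝ → ℝ} (hf : IsTemplate f) (ε t : ℝ) {w : ℝ≥0 → ℝ}
    (hw : Continuous (path w)) (k : ℤ) :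
    pathIntegral (mode k) (curve f ε t w) = mode k t * templateCoeff f k
      + ε * (stieltjes (cosMode k) (path w) - stieltjes (sinMode k) (path w) * Complex.I) := by
  have hh : ∀ a b, IntervalIntegrable (fun u => f (u - t)) volume a b := fun a b => by
    have hp : Function.Periodic (fun u => f (u - t)) 1 := fun u => by
      simp only
      rw [show u + 1 - t = u - t + 1 by ring, hf.periodic]
    have h := (hf.intervalIntegrable (0 - t) (1 - t)).comp_sub_right t
    simp only [sub_add_cancel] at h
    exact hp.intervalIntegrable₀ one_ne_zero h a b
  have hF : Continuous fun x => ∫ u in (0 : ℝ)..x, f (u - t) :=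
    intervalIntegral.continuous_primitive hh 0
  have hY : Continuous (curve f ε t w) := by
    have : curve f ε t w = fun x => (∫ u in (0 : ℝ)..x, f (u - t)) + ε * path w x := rfl
    rw [this]
    exact hF.add (continuous_const.mul hw)
  have e : ∀ φ : ℝ → ℝ, ContDiff ℝ 1 φ → stieltjes φ (curve f ε t w)
      = (∫ x in (0 : ℝ)..1, φ x * f (x - t)) + ε * stieltjes φ (path w) := by
    intro φ hφ
    rw [← stieltjes_primitive hφ (hh 0 1)]
    exact stieltjes_add_const_mul hφ hF.continuousOn hw.continuousOn ε
  have ic : IntervalIntegrable (fun x => cosMode k x * f (x - t)) volume 0 1 :=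
    (hh 0 1).continuousOn_mul (contDiff_cosMode k).continuous.continuousOn
  have is : IntervalIntegrable (fun x => sinMode k x * f (x - t)) volume 0 1 :=
    (hh 0 1).continuousOn_mul (contDiff_sinMode k).continuous.continuousOn
  have hm : ∫ x in (0 : ℝ)..1, mode k x * (f (x - t) : ℂ)
      = (∫ x in (0 : ℝ)..1, cosMode k x * f (x - t) : ℝ)
        - (∫ x in (0 : ℝ)..1, sinMode k x * f (x - t) : ℝ) * Complex.I := by
    rw [← intervalIntegral.integral_ofReal, ← intervalIntegral.integral_ofReal,
      ← intervalIntegral.integral_mul_const, ← intervalIntegral.integral_sub (intervalIntegrable_ofReal ic)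
        ((intervalIntegrable_ofReal is).mul_const _)]
    refine intervalIntegral.integral_congr fun x _ => ?_
    simp only [mode_eq]
    push_cast
    ring
  rw [pathIntegral_mode k hY.continuousOn, e _ (contDiff_cosMode k), e _ (contDiff_sinMode k),
    ← hf.integral_mode_mul_shift k t, hm]
  push_cast
  ring

theorem IsTemplate.hasSum_norm_templateCoeff_sq {f : ℝ → ℝ} (hf : IsTemplate f) :
    HasSum (fun k => ‖templateCoeff f k‖ ^ 2) (∫ x in (0 : ℝ)..1, f x ^ 2) := by
  have h := hasSum_sq_fourierCoeffOn (f := fun x => (f x : ℂ)) zero_lt_one hf.memLp.ofReal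
  have e : ∀ k, fourierCoeffOn zero_lt_one (fun x => (f x : ℂ)) k = templateCoeff f k := by
    intro k
    rw [fourierCoeffOn_eq_integral, templateCoeff]
    simp only [sub_zero, div_one, one_smul]
    refine intervalIntegral.integral_congr fun x _ => ?_
    simp only [smul_eq_mul]
    rw [fourier_coe_apply, mode]
    congr 2
    push_cast
    ring
  simp_rw [e] at h
  simpa using h

variable {Ω : Type*} {n : ℕ}

/-- Shifting a periodic template by t multiplies its k-th coefficient by `mode k t`, and cosine and
sine are half sum and half difference of `cas k` and `cas (-k)`. -/
theorem empCoeff_eq {f g : ℝ → ℝ} (hf : IsTemplate f) (hn : 0 < n) (ε : ℝ) {τ : Fin n → Ω → ℝ}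
    {W : Fin n → ℝ≥0 → Ω → ℝ} {ω : Ω} (hW : ∀ j, Continuous (path fun t => W j t ω)) {k : ℤ}
    (hk : shiftCoeff g k ≠ 0) :
    empCoeff f ε τ W ω k = templateCoeff f k * (shiftCoeff g k * (1 + shiftError g τ ω k))
      + (ε / √n : ℝ) * complexNoise (noiseCoeff W) ω k := by
  have hn' : (0 : ℝ) < n := by exact_mod_cast hn
  have hnc : (n : ℂ) ≠ 0 := by exact_mod_cast hn.ne'
  have hsq : (√n)⁻¹ * (√n)⁻¹ = (n : ℝ)⁻¹ := by rw [← mul_inv, Real.mul_self_sqrt hn'.le]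
  have e1 : shiftCoeff g k * (1 + shiftError g τ ω k)
      = (1 / (n : ℂ)) * ∑ j, mode k (τ j ω) := by
    rw [shiftError]
    field_simp
    ring
  have hc : ∀ j, stieltjes (cosMode k) (path fun t => W j t ω)
      = 1 / 2 * stieltjes (cas k) (path fun t => W j t ω)
        + 1 / 2 * stieltjes (cas (-k)) (path fun t => W j t ω) := fun j => by
    rw [show cosMode k = fun x => 1 / 2 * cas k x + 1 / 2 * cas (-k) x from
      funext (cosMode_eq_cas k)]
    exact stieltjes_add (contDiff_cas _) (contDiff_cas _) (hW j) _ _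
  have hs : ∀ j, stieltjes (sinMode k) (path fun t => W j t ω)
      = 1 / 2 * stieltjes (cas k) (path fun t => W j t ω)
        + -1 / 2 * stieltjes (cas (-k)) (path fun t => W j t ω) := fun j => by
    rw [show sinMode k = fun x => 1 / 2 * cas k x + -1 / 2 * cas (-k) x from
      funext (sinMode_eq_cas k)]
    exact stieltjes_add (contDiff_cas _) (contDiff_cas _) (hW j) _ _
  have e2 : ((ε / √n : ℝ) : ℂ) * complexNoise (noiseCoeff W) ω k
      = (1 / (n : ℂ)) * ∑ j, (ε : ℂ) * (stieltjes (cosMode k) (path fun t => W j t ω)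
        - stieltjes (sinMode k) (path fun t => W j t ω) * Complex.I) := by
    rw [← Finset.mul_sum, Finset.sum_sub_distrib, ← Finset.sum_mul, ← Complex.ofReal_sum,
      ← Complex.ofReal_sum]
    simp_rw [hc, hs]
    rw [Finset.sum_add_distrib, Finset.sum_add_distrib, ← Finset.mul_sum, ← Finset.mul_sum,
      ← Finset.mul_sum]
    set A := ∑ j, stieltjes (cas k) (path fun t => W j t ω)
    set B := ∑ j, stieltjes (cas (-k)) (path fun t => W j t ω)
    have eA : noiseCoeff W k ω = (√n)⁻¹ * A := rfl
    have eB : noiseCoeff W (-k) ω = (√n)⁻¹ * B := rfl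
    have e3 : complexNoise (noiseCoeff W) ω k
        = ((√n)⁻¹ : ℝ) * (((1 / 2 * A + 1 / 2 * B : ℝ) : ℂ)
          - ((1 / 2 * A + -1 / 2 * B : ℝ) : ℂ) * Complex.I) := by
      rw [complexNoise, eA, eB]
      generalize (√n)⁻¹ = r
      apply Complex.ext
      · simp
        ring
      · simp
        ring
    rw [e3, ← mul_assoc, ← Complex.ofReal_mul, div_eq_mul_inv, mul_assoc ε, hsq]
    push_cast
    ring
  rw [e1, e2, empCoeff]
  simp_rw [pathIntegral_curve hf ε _ (hW _)]
  rw [Finset.sum_add_distrib, ← Finset.sum_mul]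
  ring

end

/-! ### Bandwidth bounds, summability, and the loss and criterion in sequence form -/

section

theorem sq_lt_exp (y : ℝ) (hy : 0 ≤ y) : y ^ 2 < Real.exp y := by
  have h := Real.quadratic_le_exp_of_nonneg (by positivity : 0 ≤ y / 2)
  have h1 : y < 1 + y / 2 + (y / 2) ^ 2 / 2 := by nlinarith [sq_nonneg (y - 2)]
  have h2 : Real.exp y = Real.exp (y / 2) ^ 2 := by
    rw [← Real.exp_nat_mul]; congr 1; push_cast; ring
  rw [h2]
  exact pow_lt_pow_left₀ (h1.trans_le h) hy (by norm_num)

theorem log_sq_div_lt_one {n : ℕ} (hn : 0 < n) : Real.log n ^ 2 / n < 1 := by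
  have hn' : (0 : ℝ) < n := by exact_mod_cast hn
  rw [div_lt_one hn']
  have := sq_lt_exp (Real.log n) (Real.log_natCast_nonneg n)
  rwa [Real.exp_log hn'] at this

theorem lt_norm_shiftCoeff_sq {g : ℝ → ℝ} (hg : IsDensity g) {n : ℕ} (hn : 0 < n) {k : ℤ}
    (hk : k ∈ freqs (maxBandwidth g n)) : Real.log n ^ 2 / n < ‖shiftCoeff g k‖ ^ 2 := by
  rw [mem_freqs] at hk
  have e : ‖shiftCoeff g k‖ = ‖shiftCoeff g (k.natAbs : ℤ)‖ := by
    rcases Int.natAbs_eq k with h | h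
    · rw [← h]
    · conv_lhs => rw [h]
      exact norm_shiftCoeff_neg g _
  rw [e]
  have hk' : k.natAbs ≤ maxBandwidth g n := by
    rw [Int.abs_eq_natAbs] at hk
    exact_mod_cast hk
  -- Frequency 0 relies on γ_0 = 1. For positive frequencies, being at most `sInf - 1` means being
  -- strictly below `sInf`; the truncated subtraction is harmless.
  rcases Nat.eq_zero_or_pos k.natAbs with h | h
  · rw [h, Nat.cast_zero, shiftCoeff_zero hg]
    simpa using log_sq_div_lt_one hn
  · rw [maxBandwidth] at hk'
    have := Nat.notMem_of_lt_sInf (m := k.natAbs)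
      (s := {k : ℕ | ‖shiftCoeff g k‖ ^ 2 ≤ Real.log n ^ 2 / n}) (by omega)
    simpa using this

theorem invNormSq_shiftCoeff_le {g : ℝ → ℝ} {β Cmin Cmax : ℝ} (hβ : 0 ≤ β) (hCmin : 0 < Cmin)
    (hg : IsDensity g) (h : PolynomialDecay g β Cmin Cmax) {N : ℕ} {k : ℤ} (hk : k ∈ freqs N) :
    (‖shiftCoeff g k‖ ^ 2)⁻¹ ≤ max 1 (Cmin ^ 2)⁻¹ * ((N : ℝ) + 1) ^ (2 * β) := by
  have h1 : (1 : ℝ) ≤ ((N : ℝ) + 1) ^ (2 * β) :=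
    Real.one_le_rpow (by linarith [Nat.cast_nonneg (α := ℝ) N]) (by positivity)
  have hc := le_max_left 1 (Cmin ^ 2)⁻¹
  by_cases h0 : k = 0
  · rw [h0, shiftCoeff_zero hg]
    simp only [norm_one, one_pow, inv_one]
    nlinarith
  · have hk0 : 0 < |(k : ℝ)| := abs_pos.2 (by exact_mod_cast h0)
    have hkN : |(k : ℝ)| ≤ (N : ℝ) + 1 := by
      rw [mem_freqs] at hk
      have : ((|k| : ℤ) : ℝ) ≤ N := by exact_mod_cast hk
      rw [Int.cast_abs] at this
      linarith
    have hd := (h k h0).1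
    have hpos : 0 < Cmin * |(k : ℝ)| ^ (-β) := by positivity
    calc (‖shiftCoeff g k‖ ^ 2)⁻¹ ≤ ((Cmin * |(k : ℝ)| ^ (-β)) ^ 2)⁻¹ := by gcongr
      _ = (Cmin ^ 2)⁻¹ * |(k : ℝ)| ^ (2 * β) := by
          rw [mul_pow, mul_inv, ← Real.rpow_natCast (|(k : ℝ)| ^ (-β)), ← Real.rpow_mul hk0.le,
            ← Real.rpow_neg hk0.le]
          congr 2
          push_cast
          ring
      _ ≤ _ := by
          gcongr
          exact le_max_right _ _

theorem le_sum_invNormSq_shiftCoeff {g : ℝ → ℝ} {β Cmin Cmax : ℝ} (hβ : 0 ≤ β) (hCmin : 0 < Cmin)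
    (hC : Cmin ≤ Cmax) (hg : IsDensity g) (h : PolynomialDecay g β Cmin Cmax) (N : ℕ) :
    min 1 ((Cmax ^ 2)⁻¹ * (1 / 4) ^ (2 * β) / 2) * (((N : ℝ) + 1) * ((N : ℝ) + 1) ^ (2 * β))
      ≤ ∑ k ∈ freqs N, (‖shiftCoeff g k‖ ^ 2)⁻¹ := by
  have hCmax : 0 < Cmax := hCmin.trans_le hC
  rcases Nat.eq_zero_or_pos N with h0 | hN
  · subst h0
    have : freqs 0 = {0} := by ext k; simp [mem_freqs]
    rw [this, Finset.sum_singleton, shiftCoeff_zero hg]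
    simp
  -- Only the frequencies in [b, N] are kept: there are at least (N+1)/2 of them, each at least
  -- (N+1)/4.
  · set b : ℕ := (N + 1) / 2 with hb
    have hb1 : 1 ≤ b := by omega
    have hbN : (N : ℝ) + 1 ≤ 4 * b := by
      have : N + 1 ≤ 4 * b := by omega
      exact_mod_cast this
    have hsub : Finset.Icc (b : ℤ) N ⊆ freqs N := by
      intro k hk
      rw [Finset.mem_Icc] at hk
      rw [mem_freqs, abs_le]
      constructor <;> omega
    have hcard : ((N : ℝ) + 1) / 2 ≤ ((Finset.Icc (b : ℤ) N).card : ℝ) := by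
      rw [Int.card_Icc]
      have : N + 1 ≤ 2 * ((N : ℤ) + 1 - b).toNat := by omega
      have h2 : (N : ℝ) + 1 ≤ 2 * (((N : ℤ) + 1 - b).toNat : ℝ) := by exact_mod_cast this
      linarith
    have hterm : ∀ k ∈ Finset.Icc (b : ℤ) N,
        (Cmax ^ 2)⁻¹ * (1 / 4) ^ (2 * β) * ((N : ℝ) + 1) ^ (2 * β)
          ≤ (‖shiftCoeff g k‖ ^ 2)⁻¹ := by
      intro k hk
      rw [Finset.mem_Icc] at hk
      have hk0 : k ≠ 0 := by omega
      have hkpos : (0 : ℝ) < |(k : ℝ)| := abs_pos.2 (by exact_mod_cast hk0)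
      have hkb : (b : ℝ) ≤ |(k : ℝ)| := le_trans (by exact_mod_cast hk.1) (le_abs_self _)
      have hd := h k hk0
      have hγ : 0 < ‖shiftCoeff g k‖ := lt_of_lt_of_le (by positivity) hd.1
      calc (Cmax ^ 2)⁻¹ * (1 / 4) ^ (2 * β) * ((N : ℝ) + 1) ^ (2 * β)
          = (Cmax ^ 2)⁻¹ * (1 / 4 * ((N : ℝ) + 1)) ^ (2 * β) := by
            rw [Real.mul_rpow (by norm_num) (by positivity), mul_assoc]
        _ ≤ (Cmax ^ 2)⁻¹ * |(k : ℝ)| ^ (2 * β) := by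
            gcongr
            linarith
        _ = ((Cmax * |(k : ℝ)| ^ (-β)) ^ 2)⁻¹ := by
            rw [mul_pow, mul_inv, ← Real.rpow_natCast (|(k : ℝ)| ^ (-β)),
              ← Real.rpow_mul hkpos.le, ← Real.rpow_neg hkpos.le]
            congr 2
            push_cast
            ring
        _ ≤ _ := by
            gcongr
            exact hd.2
    have hsum := Finset.card_nsmul_le_sum _ _ _ hterm
    rw [nsmul_eq_mul] at hsum
    calc _ ≤ ((Cmax ^ 2)⁻¹ * (1 / 4) ^ (2 * β) / 2)
          * (((N : ℝ) + 1) * ((N : ℝ) + 1) ^ (2 * β)) := by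
          gcongr
          exact min_le_right _ _
      _ = ((N : ℝ) + 1) / 2 * ((Cmax ^ 2)⁻¹ * (1 / 4) ^ (2 * β) * ((N : ℝ) + 1) ^ (2 * β)) := by
          ring
      _ ≤ _ := by gcongr
      _ ≤ _ := hsum
      _ ≤ _ := Finset.sum_le_sum_of_subset_of_nonneg hsub fun k _ _ => by positivity

theorem summable_rpow_mul_exp (p : ℝ) {c : ℝ} (hc : 0 < c) :
    Summable fun M : ℕ => ((M : ℝ) + 1) ^ p * Real.exp (-(c * ((M : ℝ) + 1))) := by
  have h := (summable_nat_add_iff 1).2 (Real.summable_pow_mul_exp_neg_nat_mul ⌈p⌉₊ hc)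
  refine Summable.of_nonneg_of_le (fun M => by positivity) (fun M => ?_) h
  push_cast
  rw [← Real.rpow_natCast, neg_mul]
  gcongr
  · linarith [Nat.cast_nonneg (α := ℝ) M]
  · exact Nat.le_ceil p

/-- The at most N₀ + 1 indices below N₀ all contribute q(N₀). The weight M + 1 in the series pays
for them, so the bound is uniform in N₀ and m. -/
theorem sum_max_le_tsum {q : ℕ → ℝ} (hq : ∀ M, 0 ≤ q M)
    (hs : Summable fun M : ℕ => ((M : ℝ) + 1) * q M) (m N₀ : ℕ) :
    ∑ N ∈ Finset.range (m + 1), q (max N N₀) ≤ 2 * ∑' M : ℕ, ((M : ℝ) + 1) * q M := by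
  have hnn : ∀ M : ℕ, 0 ≤ ((M : ℝ) + 1) * q M := fun M => mul_nonneg (by positivity) (hq M)
  have h1 : ∑ N ∈ Finset.range (m + 1), q (max N N₀)
      ≤ ∑ N ∈ Finset.range (m + 1), ((if N ≤ N₀ then q N₀ else 0) + ((N : ℝ) + 1) * q N) := by
    refine Finset.sum_le_sum fun N _ => ?_
    have := hnn N
    split_ifs with h
    · rw [max_eq_right h]; linarith
    · rw [max_eq_left (by omega)]
      nlinarith [hq N, Nat.cast_nonneg (α := ℝ) N]
  have h2 : ∑ N ∈ Finset.range (m + 1), (if N ≤ N₀ then q N₀ else 0) ≤ ((N₀ : ℝ) + 1) * q N₀ := by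
    rw [← Finset.sum_filter, Finset.sum_const, nsmul_eq_mul]
    refine mul_le_mul_of_nonneg_right ?_ (hq _)
    have : ((Finset.range (m + 1)).filter (· ≤ N₀)).card ≤ N₀ + 1 := by
      refine (Finset.card_le_card (t := Finset.range (N₀ + 1)) fun x hx => ?_).trans_eq
        (Finset.card_range _)
      rw [Finset.mem_filter] at hx
      exact Finset.mem_range.2 (by omega)
    exact_mod_cast this
  have h3 : ((N₀ : ℝ) + 1) * q N₀ ≤ ∑' M : ℕ, ((M : ℝ) + 1) * q M :=
    hs.le_tsum N₀ fun j _ => hnn j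
  have h4 : ∑ N ∈ Finset.range (m + 1), ((N : ℝ) + 1) * q N ≤ ∑' M : ℕ, ((M : ℝ) + 1) * q M :=
    hs.sum_le_tsum _ fun j _ => hnn j
  rw [Finset.sum_add_distrib] at h1
  linarith

/-- The energy of the coefficients `θ` at the frequencies `|k| > N`. -/
noncomputable def tailEnergy (θ : ℤ → ℂ) (N : ℕ) : ℝ :=
  ∑' k : {k : ℤ // (N : ℤ) < |k|}, ‖θ k‖ ^ 2

theorem sum_freqs_add_tsum {u : ℤ → ℝ} (hu : Summable u) (N : ℕ) :
    ∑ k ∈ freqs N, u k + ∑' k : {k : ℤ // (N : ℤ) < |k|}, u k = ∑' k, u k := by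
  rw [← hu.sum_add_tsum_compl (s := freqs N)]
  congr 1
  refine (tsum_congr_set_coe u (s := {k : ℤ | (N : ℤ) < |k|}) ?_)
  ext k
  simp [mem_freqs]

theorem tailEnergy_nonneg (θ : ℤ → ℂ) (N : ℕ) : 0 ≤ tailEnergy θ N :=
  tsum_nonneg fun _ => sq_nonneg _

theorem tailEnergy_eq_add {θ : ℤ → ℂ} (hθ : Summable fun k => ‖θ k‖ ^ 2) {M M' : ℕ}
    (h : M ≤ M') :
    tailEnergy θ M = tailEnergy θ M' + ∑ k ∈ freqs M' \ freqs M, ‖θ k‖ ^ 2 := by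
  have h1 := sum_freqs_add_tsum hθ M
  have h2 := sum_freqs_add_tsum hθ M'
  rw [← Finset.sum_sdiff (freqs_mono h)] at h2
  simp only [tailEnergy]
  linarith

theorem tsum_enorm_cutoff_sub {γ c θ : ℤ → ℂ} (hθ : Summable fun k => ‖θ k‖ ^ 2) (N : ℕ) :
    ∑' k, ‖cutoffEstimator γ c N k - θ k‖ₑ ^ 2
      = ENNReal.ofReal (tailEnergy θ N + ∑ k ∈ freqs N, ‖c k / γ k - θ k‖ ^ 2) := by
  set u : ℤ → ℝ := fun k => ‖cutoffEstimator γ c N k - θ k‖ ^ 2 with hu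
  have hout : ∀ k ∉ freqs N, u k = ‖θ k‖ ^ 2 := by
    intro k hk
    rw [mem_freqs] at hk
    simp [hu, cutoffEstimator, hk]
  have hus : Summable u := by
    rw [← (freqs N).summable_compl_iff]
    refine ((freqs N).summable_compl_iff.2 hθ).congr fun k => (hout k k.2).symm
  have h1 : ∀ k, ‖cutoffEstimator γ c N k - θ k‖ₑ ^ 2 = ENNReal.ofReal (u k) := by
    intro k
    rw [hu, ENNReal.ofReal_pow (norm_nonneg _), ofReal_norm]
  simp_rw [h1]
  rw [← ENNReal.ofReal_tsum_of_nonneg (fun k => sq_nonneg _) hus, ← sum_freqs_add_tsum hus N,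
    add_comm]
  congr 2
  · refine tsum_congr fun k => hout k ?_
    rw [mem_freqs]
    exact not_le.2 k.2
  · refine Finset.sum_congr rfl fun k hk => ?_
    rw [mem_freqs] at hk
    simp [hu, cutoffEstimator, hk]

/-- The log² penalty is a_k times the first summand up to the factor -L, so the two merge into the
weight 1 - L a_k. -/
theorem criterion_eq {γ c y : ℤ → ℂ} {n : ℕ} {ε : ℝ} {N : ℕ}
    (hγ : ∀ k ∈ freqs N, γ k ≠ 0) (hc : ∀ k ∈ freqs N, c k = γ k * y k) :
    criterion γ n ε c N
      = -(∑ k ∈ freqs N, (1 - Real.log n ^ 2 / n * (‖γ k‖ ^ 2)⁻¹)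
          * (‖y k‖ ^ 2 - ε ^ 2 / n * (‖γ k‖ ^ 2)⁻¹))
        + ε ^ 2 / n * ∑ k ∈ freqs N, (‖γ k‖ ^ 2)⁻¹ := by
  rw [criterion, add_right_comm]
  congr 1
  rw [Finset.mul_sum, ← Finset.sum_neg_distrib, ← Finset.sum_neg_distrib,
    ← Finset.sum_add_distrib]
  refine Finset.sum_congr rfl fun k hk => ?_
  have h0 : ‖γ k‖ ≠ 0 := norm_ne_zero_iff.2 (hγ k hk)
  rw [hc k hk, norm_mul]
  field_simp
  ring

end

/-! ### The oracle inequality for fixed δ -/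

section

open scoped ComplexConjugate

variable {Ω : Type*} [MeasurableSpace Ω] {μ : Measure Ω} {g : ℝ → ℝ} {n : ℕ}
  {τ : Fin n → Ω → ℝ} {W : Fin n → ℝ≥0 → Ω → ℝ}

theorem IsShiftNoise.isNoise (hS : IsShiftNoise μ g τ W) : IsNoise W μ :=
  ⟨hS.measurable_noise, hS.brownian, hS.indep_noise⟩

theorem IsNoise.isStdGaussianFamily [IsProbabilityMeasure μ] (hW : IsNoise W μ) (hn : 0 < n) :
    IsStdGaussianFamily (noiseCoeff W) μ :=
  ⟨hW.aemeasurable_noiseCoeff, hW.map_noiseCoeff hn, hW.iIndepFun_noiseCoeff hn⟩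

theorem sum_sub_sum_freqs (u : ℤ → ℝ) (N N₀ : ℕ) :
    |∑ k ∈ freqs N, u k - ∑ k ∈ freqs N₀, u k|
      = |∑ k ∈ freqs (max N N₀) \ freqs (min N N₀), u k| := by
  rcases le_total N N₀ with h | h
  · rw [max_eq_right h, min_eq_left h, ← Finset.sum_sdiff (freqs_mono h), abs_sub_comm,
      add_sub_cancel_right]
  · rw [max_eq_left h, min_eq_right h, ← Finset.sum_sdiff (freqs_mono h), add_sub_cancel_right]

/-- The excess of the linear noise term between two bandwidths. -/
theorem IsStdGaussianFamily.bandwidth_excess {X : ℤ → Ω → ℝ} (hX : IsStdGaussianFamily X μ)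
    {N N₀ : ℕ} {δ s amax E : ℝ} (hδ : 0 < δ) (hs : 0 ≤ s) (hamax : 0 < amax) {a : ℤ → ℝ}
    (ha0 : ∀ k, 0 ≤ a k) {B : ℕ → ℝ} (hB0 : ∀ M, 0 ≤ B M)
    {h θ : ℤ → ℂ} (hh : ∀ k ∈ freqs (max N N₀), ‖h k‖ ^ 2 ≤ 16 * (s * amax) * ‖θ k‖ ^ 2)
    (hB : ∀ M M', M ≤ M' → B M = B M' + ∑ k ∈ freqs M' \ freqs M, ‖θ k‖ ^ 2)
    (hE : E ≤ (∑ k ∈ freqs (max N N₀), a k) / amax) :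
    Integrable (fun ω => max (|∑ k ∈ freqs (max N N₀) \ freqs (min N N₀),
        (h k * conj (complexNoise X ω k)).re|
      - δ * (B N + B N₀ + s * ∑ k ∈ freqs N, a k + s * ∑ k ∈ freqs N₀, a k)) 0) μ ∧
    ∫ ω, max (|∑ k ∈ freqs (max N N₀) \ freqs (min N N₀),
        (h k * conj (complexNoise X ω k)).re|
      - δ * (B N + B N₀ + s * ∑ k ∈ freqs N, a k + s * ∑ k ∈ freqs N₀, a k)) 0 ∂μ
      ≤ s * (32 * amax / δ * Real.exp (-(δ ^ 2 * E / 16))) := by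
  set D := freqs (max N N₀) \ freqs (min N N₀) with hD
  set SM := ∑ k ∈ freqs (max N N₀), a k with hSM
  set t := δ * (B N + B N₀ + s * ∑ k ∈ freqs N, a k + s * ∑ k ∈ freqs N₀, a k) with ht
  have hSN : 0 ≤ s * ∑ k ∈ freqs N, a k := mul_nonneg hs (Finset.sum_nonneg fun k _ => ha0 k)
  have hSN₀ : 0 ≤ s * ∑ k ∈ freqs N₀, a k := mul_nonneg hs (Finset.sum_nonneg fun k _ => ha0 k)
  have htle : δ * (B (min N N₀) + s * SM) ≤ t := by
    rw [ht]
    refine mul_le_mul_of_nonneg_left ?_ hδ.le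
    have := hB0 N
    have := hB0 N₀
    rcases le_total N N₀ with h | h
    · rw [hSM, max_eq_right h, min_eq_left h]; linarith
    · rw [hSM, max_eq_left h, min_eq_right h]; linarith
  have hDB : ∑ k ∈ D, ‖θ k‖ ^ 2 ≤ B (min N N₀) := by
    have h1 := hB (min N N₀) (max N N₀) (min_le_max)
    have := hB0 (max N N₀)
    linarith
  have hDh : ∑ k ∈ D, ‖h k‖ ^ 2 ≤ 16 * (s * amax) * B (min N N₀) := by
    refine (Finset.sum_le_sum fun k hk => hh k (Finset.mem_sdiff.1 hk).1).trans ?_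
    rw [← Finset.mul_sum]
    gcongr
  -- Without noise the choice of l below would divide by zero; then h vanishes and there is no
  -- excess.
  rcases hs.eq_or_lt with h0 | hs0
  · have hz : ∀ k ∈ D, h k = 0 := by
      intro k hk
      have := hh k (Finset.mem_sdiff.1 hk).1
      rw [← h0] at this
      simp only [zero_mul, mul_zero] at this
      simpa using le_antisymm this (sq_nonneg _)
    have hzero : ∀ ω, max (|∑ k ∈ D, (h k * conj (complexNoise X ω k)).re| - t) 0 = 0 := by
      intro ω
      rw [Finset.sum_eq_zero fun k hk => by rw [hz k hk]; simp, abs_zero, zero_sub]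
      refine max_eq_right ?_
      have h1 := hB0 (min N N₀)
      rw [← h0, zero_mul, add_zero] at htle
      have := mul_nonneg hδ.le h1
      linarith
    simp_rw [hzero]
    simp [← h0]
  -- This l makes the variance term l² · 16 s amax · B equal to the tail-energy part lδB of the
  -- threshold. Only the part δ s SM is left to give the exponential decay.
  · set l := δ / (16 * (s * amax)) with hl
    have hl0 : 0 < l := by positivity
    obtain ⟨hi, hle⟩ := hX.linear_excess (F := D) neg_mem_freqs_sdiff h hl0 t
    refine ⟨hi, hle.trans ?_⟩
    have h1 : l ^ 2 * ∑ k ∈ D, ‖h k‖ ^ 2 ≤ l * (δ * B (min N N₀)) := by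
      calc l ^ 2 * ∑ k ∈ D, ‖h k‖ ^ 2 ≤ l ^ 2 * (16 * (s * amax) * B (min N N₀)) := by gcongr
        _ = l * (δ * B (min N N₀)) := by rw [hl]; field_simp
    have h2 : l * (δ * (B (min N N₀) + s * SM)) ≤ l * t := by gcongr
    have h3 : l * (δ * (s * SM)) = δ ^ 2 * (SM / amax) / 16 := by rw [hl]; field_simp
    have h4 : δ ^ 2 * E / 16 ≤ δ ^ 2 * (SM / amax) / 16 := by gcongr
    calc 2 * l⁻¹ * Real.exp (l ^ 2 * (∑ k ∈ D, ‖h k‖ ^ 2) - l * t)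
        ≤ 2 * l⁻¹ * Real.exp (-(δ ^ 2 * E / 16)) := by
          gcongr
          linarith
      _ = _ := by rw [hl]; field_simp; norm_num

/-- The bound on the fluctuations at the bandwidth `M`. -/
noncomputable def fluctuation (β δ c₁ c₂ : ℝ) (M : ℕ) : ℝ :=
  64 * (c₂ * ((M : ℝ) + 1) ^ (2 * β)) / δ
    * Real.exp (-(δ ^ 2 * (c₁ / c₂) / 128 * ((M : ℝ) + 1)))

theorem summable_mul_fluctuation {β δ c₁ c₂ : ℝ} (hδ : 0 < δ) (hc₁ : 0 < c₁) (hc₂ : 0 < c₂) :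
    Summable fun M : ℕ => ((M : ℝ) + 1) * fluctuation β δ c₁ c₂ M := by
  have h := (summable_rpow_mul_exp (2 * β + 1)
    (by positivity : 0 < δ ^ 2 * (c₁ / c₂) / 128)).mul_left (64 * c₂ / δ)
  refine h.congr fun M => ?_
  rw [fluctuation, Real.rpow_add (by positivity), Real.rpow_one]
  ring

theorem fluctuation_nonneg {β δ c₁ c₂ : ℝ} (hδ : 0 < δ) (hc₂ : 0 < c₂) (M : ℕ) :
    0 ≤ fluctuation β δ c₁ c₂ M := by
  unfold fluctuation
  positivity

-- `pathwise_oracle` is integrated. The noise remainder 4T collects 2T from the linear excesses, T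
-- from the quadratic excesses over all bandwidths, and T from the one at N₀.
set_option maxHeartbeats 4000000 in
theorem oracle_inequality {β Cmin Cmax : ℝ} (hβ : 0 ≤ β) (hCmin : 0 < Cmin) (hC : Cmin ≤ Cmax)
    {δ : ℝ} (hδ : 0 < δ) (hδ6 : δ ≤ 1 / 6) {c₁ c₂ T : ℝ}
    (hc₁ : c₁ = min 1 ((Cmax ^ 2)⁻¹ * (1 / 4) ^ (2 * β) / 2)) (hc₂ : c₂ = max 1 (Cmin ^ 2)⁻¹)
    (hT : T = ∑' M : ℕ, ((M : ℝ) + 1) * fluctuation β δ c₁ c₂ M)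
    (hg : IsDensity g) (hdecay : PolynomialDecay g β Cmin Cmax)
    {f : ℝ → ℝ} (hf : IsTemplate f) (hn : 2 ≤ n) {ε : ℝ}
    [IsProbabilityMeasure μ] (hS : IsShiftNoise μ g τ W) {Nstar : Ω → ℕ}
    (hN : ∀ᵐ ω ∂μ, IsArgminUpTo (criterion (shiftCoeff g) n ε (empCoeff f ε τ W ω))
      (maxBandwidth g n) (Nstar ω)) {N₀ : ℕ} (hN₀ : N₀ ≤ maxBandwidth g n) :
    ∫⁻ ω, ∑' k : ℤ, ‖cutoffEstimator (shiftCoeff g) (empCoeff f ε τ W ω) (Nstar ω) k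
        - templateCoeff f k‖ₑ ^ 2 ∂μ
      ≤ ENNReal.ofReal ((1 + 10 * δ) * penalizedRisk (shiftCoeff g) (templateCoeff f) n ε N₀
          + (10 * δ⁻¹ * ((∫ x in (0 : ℝ)..1, f x ^ 2)
              * (32 * Real.exp ((1 + (δ / 2)⁻¹) ^ 2 / 2) / n))
            + ε ^ 2 / n * (4 * T))) := by
  have hn0 : 0 < n := by omega
  have hn' : (0 : ℝ) < n := by exact_mod_cast hn0
  have hCmax : 0 < Cmax := hCmin.trans_le hC
  have hc₁0 : 0 < c₁ := by rw [hc₁]; exact lt_min one_pos (by positivity)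
  have hc₂0 : 0 < c₂ := by rw [hc₂]; exact lt_max_of_lt_left one_pos
  have hX := hS.isNoise.isStdGaussianFamily hn0
  set m := maxBandwidth g n with hm
  set θ := templateCoeff f with hθdef
  set γ := shiftCoeff g with hγdef
  set L : ℝ := Real.log n ^ 2 / n with hLdef
  set s : ℝ := ε ^ 2 / n with hsdef
  set a : ℤ → ℝ := fun k => (‖γ k‖ ^ 2)⁻¹ with hadef
  set q : ℕ → ℝ := fluctuation β δ c₁ c₂ with hqdef
  set A := ∫ x in (0 : ℝ)..1, f x ^ 2 with hAdef
  set Ex := 32 * Real.exp ((1 + (δ / 2)⁻¹) ^ 2 / 2) / n with hExdef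
  have hs : 0 ≤ s := by positivity
  have hL : 0 ≤ L := by positivity
  have ha0 : ∀ k, 0 ≤ a k := fun k => by positivity
  have hsum := hf.hasSum_norm_templateCoeff_sq
  have hθ : Summable fun k => ‖θ k‖ ^ 2 := hsum.summable
  have hlt : ∀ k ∈ freqs m, L < ‖γ k‖ ^ 2 := fun k hk => lt_norm_shiftCoeff_sq hg hn0 hk
  have hγ0 : ∀ k ∈ freqs m, γ k ≠ 0 := by
    intro k hk h
    have := hlt k hk
    rw [h] at this
    simp at this
    linarith
  have hLa : ∀ k ∈ freqs m, L * a k ≤ 1 := by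
    intro k hk
    have h1 : 0 < ‖γ k‖ ^ 2 := hL.trans_lt (hlt k hk)
    rw [hadef, ← div_eq_mul_inv, div_le_one h1]
    exact (hlt k hk).le
  have hρ : ∀ k ∈ freqs m, 0 ≤ 1 - L * a k ∧ 1 - L * a k ≤ 1 := fun k hk =>
    ⟨by linarith [hLa k hk], by linarith [mul_nonneg hL (ha0 k)]⟩
  have hqnn : ∀ M, 0 ≤ q M := fluctuation_nonneg hδ hc₂0
  have hqs := summable_mul_fluctuation (β := β) hδ hc₁0 hc₂0
  have hv : ∀ M : ℕ, 0 < ((M : ℝ) + 1) ^ (2 * β) := fun M => by positivity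
  have hamax : ∀ M : ℕ, ∀ k ∈ freqs M, a k ≤ c₂ * ((M : ℝ) + 1) ^ (2 * β) := fun M k hk => by
    rw [hc₂]; exact invNormSq_shiftCoeff_le hβ hCmin hg hdecay hk
  have hSlow : ∀ M : ℕ, c₁ / c₂ * ((M : ℝ) + 1)
      ≤ (∑ k ∈ freqs M, a k) / (c₂ * ((M : ℝ) + 1) ^ (2 * β)) := by
    intro M
    have h1 := le_sum_invNormSq_shiftCoeff hβ hCmin hC hg hdecay M
    rw [← hc₁] at h1
    have := hv M
    rw [le_div_iff₀ (by positivity)]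
    refine le_trans (le_of_eq ?_) h1
    field_simp
  -- the fluctuations
  set B : ℕ → ℝ := tailEnergy θ with hBdef
  set P : ℤ → Ω → ℝ := fun k ω => max (‖shiftError g τ ω k‖ ^ 2 - δ ^ 2 * (L * a k)) 0 with hPdef
  -- The factor 4 is the one required by `pathwise_oracle`; dividing by the conjugate of γ_k turns
  -- the conjugate of η_k into that of the standardised noise.
  set h : ℤ → ℂ := fun k =>
    ((4 * (ε / √n) * (1 - L * a k) : ℝ) : ℂ) * (θ k / conj (γ k)) with hhdef
  set G : ℕ → Ω → ℝ := fun N ω => max (|∑ k ∈ freqs (max N N₀) \ freqs (min N N₀),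
        (h k * conj (complexNoise (noiseCoeff W) ω k)).re|
      - δ * (B N + B N₀ + s * ∑ k ∈ freqs N, a k + s * ∑ k ∈ freqs N₀, a k)) 0 with hGdef
  set b : ℤ → ℝ := fun k => (1 + 3 * δ + (1 + 5 * δ) * (1 - L * a k)) * a k with hbdef
  set b' : ℤ → ℝ := fun k => (2 * δ - (1 + 5 * δ) * (1 - L * a k)) * a k with hb'def
  set H : ℕ → Ω → ℝ := fun N ω => max (∑ k ∈ freqs N,
      b k * (‖complexNoise (noiseCoeff W) ω k‖ ^ 2 - 1) - δ * ∑ k ∈ freqs N, a k) 0 with hHdef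
  set H' : Ω → ℝ := fun ω => max (∑ k ∈ freqs N₀,
      b' k * (‖complexNoise (noiseCoeff W) ω k‖ ^ 2 - 1) - δ * ∑ k ∈ freqs N₀, a k) 0 with hH'def
  have hB0 : ∀ M, 0 ≤ B M := tailEnergy_nonneg θ
  have hB : ∀ M M', M ≤ M' → B M = B M' + ∑ k ∈ freqs M' \ freqs M, ‖θ k‖ ^ 2 :=
    fun M M' hMM => tailEnergy_eq_add hθ hMM
  have hσ2 : (ε / √n) ^ 2 = s := by rw [div_pow, Real.sq_sqrt hn'.le]
  have hP : ∀ k ∈ freqs m, Integrable (P k) μ ∧ ∫ ω, P k ω ∂μ ≤ Ex := fun k hk =>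
    hS.shift_excess hg hn hδ (hγ0 k hk) (hLa k hk)
  have hG : ∀ N ≤ m, Integrable (G N) μ ∧ ∫ ω, G N ω ∂μ ≤ s * q (max N N₀) := by
    intro N hNm
    have hM : max N N₀ ≤ m := max_le hNm hN₀
    have := hv (max N N₀)
    obtain ⟨i1, i2⟩ := hX.bandwidth_excess (N := N) (N₀ := N₀) (h := h) (θ := θ) hδ hs
      (by positivity : 0 < c₂ * (((max N N₀ : ℕ) : ℝ) + 1) ^ (2 * β)) ha0 hB0 (by
        intro k hk
        have hkm := freqs_mono hM hk
        obtain ⟨r0, r1⟩ := hρ k hkm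
        have e : ‖h k‖ ^ 2 = 16 * (s * (1 - L * a k) ^ 2 * a k) * ‖θ k‖ ^ 2 := by
          simp only [hhdef]
          rw [norm_mul, Complex.norm_real, norm_div, RCLike.norm_conj, mul_pow, Real.norm_eq_abs,
            sq_abs, mul_pow, mul_pow, hσ2, div_pow, div_eq_mul_inv (‖θ k‖ ^ 2)]
          ring
        rw [e]
        have h1 : (1 - L * a k) ^ 2 ≤ 1 := pow_le_one₀ r0 r1
        have h2 := hamax _ k hk
        calc 16 * (s * (1 - L * a k) ^ 2 * a k) * ‖θ k‖ ^ 2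
            ≤ 16 * (s * 1 * (c₂ * (((max N N₀ : ℕ) : ℝ) + 1) ^ (2 * β))) * ‖θ k‖ ^ 2 := by
              gcongr
          _ = _ := by ring) hB (hSlow (max N N₀))
    refine ⟨i1, i2.trans ?_⟩
    refine mul_le_mul_of_nonneg_left ?_ hs
    rw [hqdef, fluctuation]
    gcongr ?_ * _ / _ * Real.exp ?_
    -- `fluctuation` carries the larger prefactor 64 and the slower rate 1/128 of the quadratic
    -- excess, so it also dominates the linear one.
    · norm_num
    · have : 0 ≤ δ ^ 2 * (c₁ / c₂ * (((max N N₀ : ℕ) : ℝ) + 1)) := by positivity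
      linarith
  have hquad : ∀ (N : ℕ) (b : ℤ → ℝ), (∀ k ∈ freqs N, |b k| ≤ 4 * a k) →
      Integrable (fun ω => max (∑ k ∈ freqs N,
        b k * (‖complexNoise (noiseCoeff W) ω k‖ ^ 2 - 1) - δ * ∑ k ∈ freqs N, a k) 0) μ ∧
      ∫ ω, max (∑ k ∈ freqs N, b k * (‖complexNoise (noiseCoeff W) ω k‖ ^ 2 - 1)
        - δ * ∑ k ∈ freqs N, a k) 0 ∂μ ≤ q N := by
    intro N b hb
    have := hv N
    obtain ⟨i1, i2⟩ := hX.quadratic_excess hδ (by linarith)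
      (by positivity : 0 < c₂ * ((N : ℝ) + 1) ^ (2 * β)) ha0 (hamax N) hb
    refine ⟨i1, i2.trans ?_⟩
    rw [hqdef, fluctuation]
    have h1 := mul_le_mul_of_nonneg_left (hSlow N) (by positivity : 0 ≤ δ ^ 2 / 128)
    have h2 : δ ^ 2 / 128 * ((∑ k ∈ freqs N, a k) / (c₂ * ((N : ℝ) + 1) ^ (2 * β)))
        = δ ^ 2 * (∑ k ∈ freqs N, a k) / (128 * (c₂ * ((N : ℝ) + 1) ^ (2 * β))) := by
      field_simp
    rw [h2] at h1
    gcongr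
    linarith
  have hH : ∀ N ≤ m, Integrable (H N) μ ∧ ∫ ω, H N ω ∂μ ≤ q N := by
    intro N hNm
    refine hquad N b fun k hk => ?_
    obtain ⟨r0, r1⟩ := hρ k (freqs_mono hNm hk)
    simp only [hbdef]
    rw [abs_mul, abs_of_nonneg (ha0 k)]
    refine mul_le_mul_of_nonneg_right ?_ (ha0 k)
    rw [abs_le]
    constructor <;> nlinarith
  have hH' : Integrable H' μ ∧ ∫ ω, H' ω ∂μ ≤ q N₀ := by
    refine hquad N₀ b' fun k hk => ?_
    obtain ⟨r0, r1⟩ := hρ k (freqs_mono hN₀ hk)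
    simp only [hb'def]
    rw [abs_mul, abs_of_nonneg (ha0 k)]
    refine mul_le_mul_of_nonneg_right ?_ (ha0 k)
    rw [abs_le]
    constructor <;> nlinarith
  -- The excesses at the random bandwidth are dominated by their sums over all bandwidths up to m,
  -- since each is nonnegative.
  set V : Ω → ℝ := fun ω => 10 * δ⁻¹ * ∑ k ∈ freqs m, ‖θ k‖ ^ 2 * P k ω
    + (∑ N ∈ Finset.range (m + 1), G N ω + s * ∑ N ∈ Finset.range (m + 1), H N ω + s * H' ω)
    with hVdef
  have hG0 : ∀ N ω, 0 ≤ G N ω := fun N ω => le_max_right _ _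
  have hH0 : ∀ N ω, 0 ≤ H N ω := fun N ω => le_max_right _ _
  have hH'0 : ∀ ω, 0 ≤ H' ω := fun ω => le_max_right _ _
  have hP0 : ∀ k ω, 0 ≤ P k ω := fun k ω => le_max_right _ _
  have hV0 : ∀ ω, 0 ≤ V ω := by
    intro ω
    have h1 : 0 ≤ ∑ k ∈ freqs m, ‖θ k‖ ^ 2 * P k ω :=
      Finset.sum_nonneg fun k _ => mul_nonneg (sq_nonneg _) (hP0 k ω)
    have h2 : 0 ≤ ∑ N ∈ Finset.range (m + 1), G N ω := Finset.sum_nonneg fun N _ => hG0 N ω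
    have h3 : 0 ≤ ∑ N ∈ Finset.range (m + 1), H N ω := Finset.sum_nonneg fun N _ => hH0 N ω
    have h4 := hH'0 ω
    positivity
  -- the pathwise bound
  have hpath : ∀ᵐ ω ∂μ, ∑' k : ℤ, ‖cutoffEstimator γ (empCoeff f ε τ W ω) (Nstar ω) k - θ k‖ₑ ^ 2
      ≤ ENNReal.ofReal ((1 + 10 * δ) * penalizedRisk γ θ n ε N₀ + V ω) := by
    filter_upwards [hN, hS.isNoise.ae_continuous] with ω hω hc
    obtain ⟨hNm, hmin⟩ := hω
    rw [tsum_enorm_cutoff_sub hθ]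
    refine ENNReal.ofReal_le_ofReal ?_
    set N := Nstar ω
    set η : ℤ → ℂ := fun k => ((ε / √n : ℝ) : ℂ) * complexNoise (noiseCoeff W) ω k / γ k with hηdef
    have hemp : ∀ k ∈ freqs m, empCoeff f ε τ W ω k
        = γ k * (θ k * (1 + shiftError g τ ω k) + η k) := by
      intro k hk
      have := hγ0 k hk
      rw [empCoeff_eq hf hn0 ε hc this]
      simp only [hηdef, hθdef, hγdef] at this ⊢
      field_simp
    have hηsq : ∀ k, ‖η k‖ ^ 2 = s * a k * ‖complexNoise (noiseCoeff W) ω k‖ ^ 2 := by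
      intro k
      simp only [hηdef]
      rw [norm_div, norm_mul, Complex.norm_real, div_pow, mul_pow, Real.norm_eq_abs, sq_abs, hσ2,
        div_eq_mul_inv]
      ring
    have hloss : ∑ k ∈ freqs N, ‖empCoeff f ε τ W ω k / γ k - θ k‖ ^ 2
        = ∑ k ∈ freqs N, ‖θ k * shiftError g τ ω k + η k‖ ^ 2 := by
      refine Finset.sum_congr rfl fun k hk => ?_
      have hkm := freqs_mono hNm hk
      rw [hemp k hkm, mul_div_cancel_left₀ _ (hγ0 k hkm)]
      congr 2
      ring
    have hU := hmin N₀ hN₀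
    rw [criterion_eq (fun k hk => hγ0 k (freqs_mono hNm hk))
        (fun k hk => hemp k (freqs_mono hNm hk)),
      criterion_eq (fun k hk => hγ0 k (freqs_mono hN₀ hk))
        (fun k hk => hemp k (freqs_mono hN₀ hk))] at hU
    have hGω : 4 * |∑ k ∈ freqs N, (1 - L * a k) * (θ k * conj (η k)).re
        - ∑ k ∈ freqs N₀, (1 - L * a k) * (θ k * conj (η k)).re|
        ≤ G N ω + δ * (B N + B N₀ + s * ∑ k ∈ freqs N, a k + s * ∑ k ∈ freqs N₀, a k) := by
      rw [sum_sub_sum_freqs]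
      have e : 4 * |∑ k ∈ freqs (max N N₀) \ freqs (min N N₀),
          (1 - L * a k) * (θ k * conj (η k)).re|
          = |∑ k ∈ freqs (max N N₀) \ freqs (min N N₀),
            (h k * conj (complexNoise (noiseCoeff W) ω k)).re| := by
        rw [← abs_of_pos (by norm_num : (0 : ℝ) < 4), ← abs_mul, Finset.mul_sum]
        congr 1
        refine Finset.sum_congr rfl fun k _ => ?_
        have e1 : h k * conj (complexNoise (noiseCoeff W) ω k)
            = ((4 * (1 - L * a k) : ℝ) : ℂ) * (θ k * conj (η k)) := by
          simp only [hhdef, hηdef, map_div₀, map_mul, Complex.conj_ofReal]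
          push_cast
          ring
        rw [e1, Complex.re_ofReal_mul]
        ring
      rw [e]
      have := le_max_left (|∑ k ∈ freqs (max N N₀) \ freqs (min N N₀),
        (h k * conj (complexNoise (noiseCoeff W) ω k)).re|
        - δ * (B N + B N₀ + s * ∑ k ∈ freqs N, a k + s * ∑ k ∈ freqs N₀, a k)) 0
      simp only [hGdef]
      linarith
    have hHω : ∑ k ∈ freqs N, (1 + 3 * δ + (1 + 5 * δ) * (1 - L * a k)) * (‖η k‖ ^ 2 - s * a k)
        ≤ s * H N ω + δ * (s * ∑ k ∈ freqs N, a k) := by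
      have e : ∑ k ∈ freqs N, (1 + 3 * δ + (1 + 5 * δ) * (1 - L * a k)) * (‖η k‖ ^ 2 - s * a k)
          = s * ∑ k ∈ freqs N, b k * (‖complexNoise (noiseCoeff W) ω k‖ ^ 2 - 1) := by
        rw [Finset.mul_sum]
        refine Finset.sum_congr rfl fun k _ => ?_
        rw [hηsq]
        simp only [hbdef]
        ring
      rw [e]
      have := mul_le_mul_of_nonneg_left (le_max_left (∑ k ∈ freqs N,
        b k * (‖complexNoise (noiseCoeff W) ω k‖ ^ 2 - 1) - δ * ∑ k ∈ freqs N, a k) 0) hs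
      simp only [hHdef]
      linarith
    have hH'ω : ∑ k ∈ freqs N₀, (2 * δ - (1 + 5 * δ) * (1 - L * a k)) * (‖η k‖ ^ 2 - s * a k)
        ≤ s * H' ω + δ * (s * ∑ k ∈ freqs N₀, a k) := by
      have e : ∑ k ∈ freqs N₀, (2 * δ - (1 + 5 * δ) * (1 - L * a k)) * (‖η k‖ ^ 2 - s * a k)
          = s * ∑ k ∈ freqs N₀, b' k * (‖complexNoise (noiseCoeff W) ω k‖ ^ 2 - 1) := by
        rw [Finset.mul_sum]
        refine Finset.sum_congr rfl fun k _ => ?_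
        rw [hηsq]
        simp only [hb'def]
        ring
      rw [e]
      have := mul_le_mul_of_nonneg_left (le_max_left (∑ k ∈ freqs N₀,
        b' k * (‖complexNoise (noiseCoeff W) ω k‖ ^ 2 - 1) - δ * ∑ k ∈ freqs N₀, a k) 0) hs
      simp only [hH'def]
      linarith
    have key := pathwise_oracle hNm hN₀ hδ hδ6 hL hs ha0 hLa (fun k => hP0 k ω)
      (z := shiftError g τ ω) (fun k _ => by
        have := le_max_left (‖shiftError g τ ω k‖ ^ 2 - δ ^ 2 * (L * a k)) 0
        simp only [hPdef]
        linarith) hB0 hB hU hGω hHω hH'ω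
    rw [hloss]
    refine key.trans ?_
    have hmem : N ∈ Finset.range (m + 1) := Finset.mem_range.2 (by omega)
    have s1 : G N ω ≤ ∑ N ∈ Finset.range (m + 1), G N ω :=
      Finset.single_le_sum (f := fun N => G N ω) (fun M _ => hG0 M ω) hmem
    have s2 : H N ω ≤ ∑ N ∈ Finset.range (m + 1), H N ω :=
      Finset.single_le_sum (f := fun N => H N ω) (fun M _ => hH0 M ω) hmem
    have s3 := mul_le_mul_of_nonneg_left s2 hs
    have e : penalizedRisk γ θ n ε N₀ = B N₀ + s * ∑ k ∈ freqs N₀, a k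
        + L * ∑ k ∈ freqs N₀, a k * ‖θ k‖ ^ 2 := rfl
    rw [e]
    simp only [hVdef]
    linarith
  -- integration
  have iP : Integrable (fun ω => ∑ k ∈ freqs m, ‖θ k‖ ^ 2 * P k ω) μ :=
    integrable_finsetSum _ fun k hk => (hP k hk).1.const_mul _
  have iG : Integrable (fun ω => ∑ N ∈ Finset.range (m + 1), G N ω) μ :=
    integrable_finsetSum _ fun N hNr => (hG N (by have := Finset.mem_range.1 hNr; omega)).1
  have iH : Integrable (fun ω => ∑ N ∈ Finset.range (m + 1), H N ω) μ :=
    integrable_finsetSum _ fun N hNr => (hH N (by have := Finset.mem_range.1 hNr; omega)).1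
  have iGH : Integrable (fun ω => ∑ N ∈ Finset.range (m + 1), G N ω
      + s * ∑ N ∈ Finset.range (m + 1), H N ω) μ := iG.add (iH.const_mul s)
  have iGHH : Integrable (fun ω => ∑ N ∈ Finset.range (m + 1), G N ω
      + s * ∑ N ∈ Finset.range (m + 1), H N ω + s * H' ω) μ := iGH.add (hH'.1.const_mul s)
  have iV : Integrable V μ := (iP.const_mul (10 * δ⁻¹)).add iGHH
  have hEx : 0 ≤ Ex := by positivity
  have bP : ∫ ω, ∑ k ∈ freqs m, ‖θ k‖ ^ 2 * P k ω ∂μ ≤ A * Ex := by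
    rw [integral_finsetSum _ fun k hk => (hP k hk).1.const_mul _]
    calc _ ≤ ∑ k ∈ freqs m, ‖θ k‖ ^ 2 * Ex := by
          refine Finset.sum_le_sum fun k hk => ?_
          rw [integral_const_mul]
          exact mul_le_mul_of_nonneg_left (hP k hk).2 (sq_nonneg _)
      _ = (∑ k ∈ freqs m, ‖θ k‖ ^ 2) * Ex := by rw [Finset.sum_mul]
      _ ≤ A * Ex := by
          refine mul_le_mul_of_nonneg_right ?_ hEx
          exact sum_le_hasSum _ (fun k _ => sq_nonneg _) hsum
  have bG : ∫ ω, ∑ N ∈ Finset.range (m + 1), G N ω ∂μ ≤ s * (2 * T) := by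
    rw [integral_finsetSum _ fun N hNr => (hG N (by have := Finset.mem_range.1 hNr; omega)).1]
    calc _ ≤ ∑ N ∈ Finset.range (m + 1), s * q (max N N₀) :=
          Finset.sum_le_sum fun N hNr => (hG N (by have := Finset.mem_range.1 hNr; omega)).2
      _ = s * ∑ N ∈ Finset.range (m + 1), q (max N N₀) := by rw [Finset.mul_sum]
      _ ≤ s * (2 * T) := by
          rw [hT]
          exact mul_le_mul_of_nonneg_left (sum_max_le_tsum hqnn hqs m N₀) hs
  have hqle : ∀ M, q M ≤ ((M : ℝ) + 1) * q M := fun M => by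
    nlinarith [hqnn M, Nat.cast_nonneg (α := ℝ) M]
  have hqnn' : ∀ M : ℕ, 0 ≤ ((M : ℝ) + 1) * q M := fun M => (hqnn M).trans (hqle M)
  have bH : ∫ ω, ∑ N ∈ Finset.range (m + 1), H N ω ∂μ ≤ T := by
    rw [integral_finsetSum _ fun N hNr => (hH N (by have := Finset.mem_range.1 hNr; omega)).1]
    calc _ ≤ ∑ N ∈ Finset.range (m + 1), ((N : ℝ) + 1) * q N :=
          Finset.sum_le_sum fun N hNr =>
            ((hH N (by have := Finset.mem_range.1 hNr; omega)).2).trans (hqle N)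
      _ ≤ T := by
          rw [hT]
          exact hqs.sum_le_tsum _ fun j _ => hqnn' j
  have bH' : ∫ ω, H' ω ∂μ ≤ T := by
    refine hH'.2.trans ((hqle N₀).trans ?_)
    rw [hT]
    exact hqs.le_tsum N₀ fun j _ => hqnn' j
  have bV : ∫ ω, V ω ∂μ ≤ 10 * δ⁻¹ * (A * Ex) + s * (4 * T) := by
    have e : ∫ ω, V ω ∂μ = 10 * δ⁻¹ * ∫ ω, ∑ k ∈ freqs m, ‖θ k‖ ^ 2 * P k ω ∂μ
        + (∫ ω, ∑ N ∈ Finset.range (m + 1), G N ω ∂μ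
          + s * ∫ ω, ∑ N ∈ Finset.range (m + 1), H N ω ∂μ + s * ∫ ω, H' ω ∂μ) := by
      simp only [hVdef]
      rw [integral_add (iP.const_mul _) iGHH, integral_add iGH (hH'.1.const_mul s),
        integral_add iG (iH.const_mul s), integral_const_mul, integral_const_mul,
        integral_const_mul]
    rw [e]
    have h1 : 10 * δ⁻¹ * ∫ ω, ∑ k ∈ freqs m, ‖θ k‖ ^ 2 * P k ω ∂μ ≤ 10 * δ⁻¹ * (A * Ex) := by
      gcongr
    have h2 := mul_le_mul_of_nonneg_left bH hs
    have h3 := mul_le_mul_of_nonneg_left bH' hs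
    linarith
  have hR0 : 0 ≤ (1 + 10 * δ) * penalizedRisk γ θ n ε N₀ := by
    have e : penalizedRisk γ θ n ε N₀ = B N₀ + s * ∑ k ∈ freqs N₀, a k
        + L * ∑ k ∈ freqs N₀, a k * ‖θ k‖ ^ 2 := rfl
    rw [e]
    have h1 := hB0 N₀
    have h2 : 0 ≤ ∑ k ∈ freqs N₀, a k := Finset.sum_nonneg fun k _ => ha0 k
    have h3 : 0 ≤ ∑ k ∈ freqs N₀, a k * ‖θ k‖ ^ 2 :=
      Finset.sum_nonneg fun k _ => mul_nonneg (ha0 k) (sq_nonneg _)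
    positivity
  calc _ ≤ ∫⁻ ω, ENNReal.ofReal ((1 + 10 * δ) * penalizedRisk γ θ n ε N₀ + V ω) ∂μ :=
        lintegral_mono_ae hpath
    _ = ENNReal.ofReal (∫ ω, ((1 + 10 * δ) * penalizedRisk γ θ n ε N₀ + V ω) ∂μ) := by
        have iRV : Integrable (fun ω => (1 + 10 * δ) * penalizedRisk γ θ n ε N₀ + V ω) μ :=
          (integrable_const _).add iV
        rw [ofReal_integral_eq_lintegral_ofReal iRV
          (ae_of_all _ fun ω => add_nonneg hR0 (hV0 ω))]
    _ ≤ _ := by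
        refine ENNReal.ofReal_le_ofReal ?_
        rw [integral_add (integrable_const _) iV]
        simp only [integral_const, probReal_univ, one_smul]
        linarith

end

/-! ### Choice of δ as a function of γ, and the conclusion -/

section

/-- A sequence that grows to infinity so slowly that `K` along it is dominated by `1 / γ`. -/
theorem exists_tendsto_atTop_le_inv (K : ℕ → ℝ) :
    ∃ j : ℝ → ℕ, Tendsto j (𝓝[>] 0) atTop ∧ ∀ᶠ γ in 𝓝[>] (0 : ℝ), K (j γ) ≤ γ⁻¹ := by
  classical
  -- The largest admissible index up to 1/γ. Any fixed i is eventually admissible, so j diverges,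
  -- and no growth rate of K is needed; admissibility of 0 guards against the default value of
  -- `Nat.findGreatest`.
  set j : ℝ → ℕ := fun γ => Nat.findGreatest (fun i => K i ≤ γ⁻¹) ⌊γ⁻¹⌋₊ with hj
  have hev : ∀ i, ∀ᶠ γ in 𝓝[>] (0 : ℝ), K i ≤ γ⁻¹ ∧ i ≤ ⌊γ⁻¹⌋₊ := fun i =>
    (tendsto_inv_nhdsGT_zero.eventually_ge_atTop (K i)).and
      ((tendsto_nat_floor_atTop.comp tendsto_inv_nhdsGT_zero).eventually_ge_atTop i)
  refine ⟨j, tendsto_atTop.2 fun i => ?_, ?_⟩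
  · filter_upwards [hev i] with γ hγ
    exact Nat.le_findGreatest hγ.2 hγ.1
  · filter_upwards [hev 0] with γ hγ
    exact Nat.findGreatest_spec (P := fun i => K i ≤ γ⁻¹) (Nat.zero_le _) hγ.1

end

end ShiftedCurves

theorem mainTheorem1 (β Cmin Cmax : ℝ) (hβ : 0 ≤ β) (hCmin : 0 < Cmin) (hC : Cmin ≤ Cmax) :
    ∃ γ₁ : ℝ, 0 < γ₁ ∧ γ₁ < 1 ∧
    ∃ h₁ : ℝ → ℝ, Tendsto h₁ (𝓝[>] 0) (𝓝 0) ∧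
    ∀ A : ℝ, ∃ C₁ : ℝ, 0 < C₁ ∧
    ∀ g : ℝ → ℝ, ShiftedCurves.IsDensity g → ShiftedCurves.PolynomialDecay g β Cmin Cmax →
    ∀ f : ℝ → ℝ, ShiftedCurves.IsTemplate f → ∫ x in (0 : ℝ)..1, f x ^ 2 ≤ A →
    ∀ n : ℕ, 2 ≤ n → ∀ ε : ℝ, 0 ≤ ε →
    ∀ (Ω : Type*) [MeasurableSpace Ω] (μ : Measure Ω) [IsProbabilityMeasure μ]
      (τ : Fin n → Ω → ℝ) (W : Fin n → ℝ≥0 → Ω → ℝ), ShiftedCurves.IsShiftNoise μ g τ W →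
    ∀ Nstar : Ω → ℕ, AEMeasurable Nstar μ →
      (∀ᵐ ω ∂μ, ShiftedCurves.IsArgminUpTo
        (ShiftedCurves.criterion (ShiftedCurves.shiftCoeff g) n ε
          (ShiftedCurves.empCoeff f ε τ W ω))
        (ShiftedCurves.maxBandwidth g n) (Nstar ω)) →
    ∀ γ : ℝ, 0 < γ → γ < γ₁ →
      ∫⁻ ω, ∑' k : ℤ,
          ‖ShiftedCurves.cutoffEstimator (ShiftedCurves.shiftCoeff g)
              (ShiftedCurves.empCoeff f ε τ W ω) (Nstar ω) k
            - ShiftedCurves.templateCoeff f k‖ₑ ^ 2 ∂μ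
        ≤ ENNReal.ofReal
          ((1 + h₁ γ) * (⨅ N : Fin (ShiftedCurves.maxBandwidth g n + 1),
              ShiftedCurves.penalizedRisk (ShiftedCurves.shiftCoeff g)
                (ShiftedCurves.templateCoeff f) n ε N)
            + C₁ * ε ^ 2 / n * (1 / γ ^ (4 * β + 1))
            + C₁ / (n * γ)) := by
  set δ : ℕ → ℝ := fun i => 1 / ((i : ℝ) + 6) with hδdef
  have hδ0 : ∀ i, 0 < δ i := fun i => by positivity
  have hδ6 : ∀ i, δ i ≤ 1 / 6 := fun i =>
    one_div_le_one_div_of_le (by norm_num) (by linarith [Nat.cast_nonneg (α := ℝ) i])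
  have hδlim : Tendsto δ atTop (𝓝 0) :=
    tendsto_const_nhds.div_atTop (tendsto_natCast_atTop_atTop.atTop_add tendsto_const_nhds)
  set c₁ : ℝ := min 1 ((Cmax ^ 2)⁻¹ * (1 / 4) ^ (2 * β) / 2) with hc₁
  set c₂ : ℝ := max 1 (Cmin ^ 2)⁻¹ with hc₂
  set T : ℕ → ℝ := fun i =>
    ∑' M : ℕ, ((M : ℝ) + 1) * ShiftedCurves.fluctuation β (δ i) c₁ c₂ M with hTdef
  set E : ℕ → ℝ := fun i =>
    10 * (δ i)⁻¹ * (32 * Real.exp ((1 + (δ i / 2)⁻¹) ^ 2 / 2)) with hEdef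
  obtain ⟨j, hj, hjK⟩ :=
    ShiftedCurves.exists_tendsto_atTop_le_inv fun i => max (E i) (4 * T i)
  obtain ⟨u, hu, hju⟩ := mem_nhdsGT_iff_exists_Ioo_subset.1 hjK
  have hu0 : 0 < u := hu
  -- Below u the constants at δ (j γ) are at most 1/γ; neither u nor j involves A. The constant max
  -- A 0 + 1 bounds ∫ f² in the shift remainder and is at least 1, as the noise remainder needs.
  refine ⟨min u (1 / 2), lt_min hu0 (by norm_num), (min_le_right _ _).trans_lt (by norm_num),
    fun γ => 10 * δ (j γ), ?_, fun A => ⟨max A 0 + 1, by positivity, ?_⟩⟩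
  · simpa using (hδlim.comp hj).const_mul 10
  intro g hg hdecay f hf hfA n hn ε hε Ω _ μ _ τ W hS Nstar _ hN γ hγ hγ₁
  have hK : max (E (j γ)) (4 * T (j γ)) ≤ γ⁻¹ := hju ⟨hγ, hγ₁.trans_le (min_le_left _ _)⟩
  have hγ1 : γ ≤ 1 := by linarith [hγ₁.trans_le (min_le_right u (1 / 2))]
  have hn' : (0 : ℝ) < n := by exact_mod_cast (by omega : 0 < n)
  obtain ⟨N₀, hN₀⟩ := exists_eq_ciInf_of_finite
    (f := fun N : Fin (ShiftedCurves.maxBandwidth g n + 1) =>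
      ShiftedCurves.penalizedRisk (ShiftedCurves.shiftCoeff g)
        (ShiftedCurves.templateCoeff f) n ε N)
  refine (ShiftedCurves.oracle_inequality hβ hCmin hC (hδ0 (j γ)) (hδ6 (j γ)) hc₁ hc₂ rfl hg hdecay
    hf hn hS hN (Nat.lt_succ_iff.1 N₀.2)).trans (ENNReal.ofReal_le_ofReal ?_)
  rw [← hN₀, add_assoc ((1 + 10 * δ (j γ)) * _)]
  refine add_le_add_right ?_ _
  have hA0 : (0 : ℝ) ≤ max A 0 := le_max_right _ _
  have hf0 : 0 ≤ ∫ x in (0 : ℝ)..1, f x ^ 2 :=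
    intervalIntegral.integral_nonneg zero_le_one fun x _ => sq_nonneg _
  have hfC : ∫ x in (0 : ℝ)..1, f x ^ 2 ≤ max A 0 + 1 := by linarith [le_max_left A 0]
  have hpow : γ⁻¹ ≤ 1 / γ ^ (4 * β + 1) := by
    rw [← one_div]
    exact one_div_le_one_div_of_le (by positivity)
      ((Real.rpow_le_rpow_of_exponent_ge hγ hγ1 (by linarith : 1 ≤ 4 * β + 1)).trans_eq
        (Real.rpow_one γ))
  have hshift : 10 * (δ (j γ))⁻¹ * ((∫ x in (0 : ℝ)..1, f x ^ 2)
      * (32 * Real.exp ((1 + (δ (j γ) / 2)⁻¹) ^ 2 / 2) / n)) ≤ (max A 0 + 1) / (n * γ) := by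
    calc _ = (∫ x in (0 : ℝ)..1, f x ^ 2) * E (j γ) / n := by simp only [hEdef]; ring
      _ ≤ (max A 0 + 1) * γ⁻¹ / n := by
        have h1 := (le_max_left _ _).trans hK
        have h2 : 0 ≤ γ⁻¹ := by positivity
        gcongr
      _ = _ := by field_simp
  have hnoise : ε ^ 2 / n * (4 * T (j γ))
      ≤ (max A 0 + 1) * ε ^ 2 / n * (1 / γ ^ (4 * β + 1)) := by
    have h1 := ((le_max_right _ _).trans hK).trans hpow
    have h2 : 0 ≤ 1 / γ ^ (4 * β + 1) := by positivity
    calc _ ≤ ε ^ 2 / n * (1 / γ ^ (4 * β + 1)) := by gcongr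
      _ = 1 * (ε ^ 2 / n * (1 / γ ^ (4 * β + 1))) := (one_mul _).symm
      _ ≤ (max A 0 + 1) * (ε ^ 2 / n * (1 / γ ^ (4 * β + 1))) := by
        gcongr
        linarith
      _ = _ := by ring
  linarith
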